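/- **Theorem 1.4.** Let $\mathcal L_0\subseteq\mathcal L$ be first-order languages, let $T$ be an $\mathcal L$-theory and let $T_0$ be its reduct to $\mathcal L_0$ (that is, $T_0$ axiomatises the set of $\mathcal L_0$-consequences of $T$). Let $\mathcal L_S=\mathcal L\cup\{S\}$ with $S$ a new unary predicate, and let $T_S$ be the $\mathcal L_S$-theory of the pairs $(M,M_0)$ where $M\models T$ and $M_0=S(M)$ is a substructure of $M\upharpoonright\mathcal L_0$ with $M_0\models T_0$. Let $\mathrm{acl}_0$ be algebraic closure in the sense of $T_0$, i.e. $\mathrm{acl}_0(A)$ is the union of the finite sets definable by $\mathcal L_0$-formulas with parameters from $A$. A tuple $a=(a_i)_i$ is *independent over* $C$ if $a_i\notin \mathrm{acl}_0(C\cup\{a_j:j\ne i\})$ for all $i$. Write $A\perp^0_C B$ if every finite tuple from $A$ that is independent over $C$ is independent over $C\cup B$. An extension $(M,M_0)\subseteq(N,N_0)$ is *strong* if $N_0\perp^0_{M_0}M$ (in $N$). All tuples of variables below are finite. An $\mathcal L_0$-formula $\tau(t,x,y)$, with $t$ a single variable and $x=x^0x^1$, is *algebraic in $t$* if there is $k$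 such that in all models of $T_0$ it has at most $k$ solutions $t$ for all values of $x,y$; it is *strict in $x^1$* if, in all models of $T_0$, for all tuples $a=a^0a^1$ and $b$ with $a^1$ independent over $a^0b$, all solutions of $\tau(t,a,b)$ lie in $\mathrm{acl}_0(ab)\setminus\mathrm{acl}_0(a^0b)$. Assume: * $(H_1)$ $T$ is model complete; * $(H_2)$ $T_0$ is model complete, and $\mathrm{acl}_0(A)\models T_0$ for all infinite subsets $A$ of models of $T_0$; * $(H_3)$ $T_0$ is pregeometric, i.e. $\mathrm{acl}_0$ satisfies exchange in models of $T_0$; * $(H_4)$ for every $\mathcal L$-formula $\phi(x,y)$ there is an $\mathcal L$-formula $\theta_\phi(y)$ such that for all $M\models T$ and $b$ from $M$: $M\models\theta_\phi(b)$ if and only if there are $N\succ M$ and a tuple $a$ from $N$ such that $N\models\phi(a,b)$ and $a$ is independent over $M$. Fix formulas $\theta_\phi$ as in $(H_4)$, and let $TS\supseteq T_S$ be the theory obtained by adding to $T_S$ the axioms $$\forall y\Big(\theta_\phi(y)\rightarrow\exists x\big(\phi(x,y)\wedge x^0\subseteq S\wedge\bigwedge_{i<k}\forall t\,(\tau_i(t,x,y)\rightarrow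 t\notin S)\big)\Big)$$ for all tuples of variables $x=x^0x^1$ and $y$, all $\mathcal L$-formulas $\phi(x,y)$ and all finite families $(\tau_i(t,x,y))_{i<k}$ of $\mathcal L_0$-formulas which are algebraic in $t$ and strict in $x^1$. Then: 1. every model of $T_S$ has a strong extension which is a model of $TS$; 2. if $(M,M_0)\models TS$ and $(N,N_0)\models T_S$ is a strong extension of $(M,M_0)$, then $(M,M_0)$ is existentially closed in $(N,N_0)$; 3. if moreover the pregeometry $\mathrm{acl}_0$ is modular (in every model of $T_0$, $A\perp^0_{A\cap B}B$ for any two $\mathrm{acl}_0$-closed sets $A,B$), then $TS$ is the model companion of $T_S$: it is model complete, every model of $T_S$ embeds in a model of $TS$, and every model of $TS$ embeds in a model of $T_S$. -/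

import Mathlib

open FirstOrder FirstOrder.Language

universe u v w

namespace ReductExpansion

/-! Throughout, `h : L₀ →ᴸ L` is the inclusion of a sublanguage, so that every `L`-structure is also
an `L₀`-structure: an `L₀`-formula `ψ` is evaluated in it through `h.onFormula ψ`. -/

section Closure

variable {L₀ : FirstOrder.Language.{u, v}} {L : FirstOrder.Language.{u, v}} (h : L₀ →ᴸ L) {M : Type*} [L.Structure M]

/-- Algebraic closure of `A` in the `L₀`-reduct of `M`: all elements of finite sets that are
definable by an `L₀`-formula with parameters from `A`. -/
def acl (A : Set M) : Set M :=
  {c | ∃ ψ : L₀.Formula (A ⊕ Unit),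
    (h.onFormula ψ).Realize (Sum.elim (fun a : A => (a : M)) fun _ => c) ∧
    {t : M | (h.onFormula ψ).Realize (Sum.elim (fun a : A => (a : M)) fun _ => t)}.Finite}

/-- The tuple `a` is independent over `C` with respect to `acl`: no coordinate is algebraic over
`C` together with the other coordinates. -/
def IndependentOver {ι : Type*} (a : ι → M) (C : Set M) : Prop :=
  ∀ i, a i ∉ acl h (C ∪ a '' {j | j ≠ i})

/-- The relation `A ⫝⁰_C B` of the pregeometry `acl`: every finite tuple of elements of `A` which
is independent over `C` stays independent over `C ∪ B`
(equivalently, `dim(a / C ∪ B) = dim(a / C)` for all finite tuples `a` from `A`). -/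
def Indep (A C B : Set M) : Prop :=
  ∀ (n : ℕ) (a : Fin n → M), (∀ i, a i ∈ A) → IndependentOver h a C → IndependentOver h a (C ∪ B)

end Closure

section Theories

variable {L₀ : FirstOrder.Language.{u, v}} {L : FirstOrder.Language.{u, v}}

/-- `T₀` is the reduct of `T` to `L₀`: it axiomatises the set of `L₀`-consequences of `T`. -/
def IsReduct (h : L₀ →ᴸ L) (T₀ : L₀.Theory) (T : L.Theory) : Prop :=
  ∀ σ : L₀.Sentence, T₀ ⊨ᵇ σ ↔ T ⊨ᵇ h.onSentence σ

/-- Every embedding between models of `T` is elementary. -/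
def IsModelComplete (T : L.Theory) : Prop :=
  ∀ (M N : Theory.ModelType.{u, v, max u v w} T) (f : M ↪[L] N) (n : ℕ) (ψ : L.Formula (Fin n))
    (x : Fin n → M), ψ.Realize (f ∘ x) ↔ ψ.Realize x

/-- The algebraic closure of any infinite subset of a model of `T₀` is (the universe of a
substructure which is) a model of `T₀`. -/
def InfiniteAclModels (T₀ : L₀.Theory) : Prop :=
  ∀ (M : Theory.ModelType.{u, v, max u v w} T₀) (A : Set M), A.Infinite →
    ∃ P : L₀.Substructure M, (P : Set M) = acl (LHom.id L₀) A ∧ P ⊨ T₀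

/-- `acl` satisfies the exchange property in all models of `T₀`. -/
def IsPregeometric (T₀ : L₀.Theory) : Prop :=
  ∀ (M : Theory.ModelType.{u, v, max u v w} T₀) (A : Set M) (a b : M),
    a ∈ acl (LHom.id L₀) (insert b A) → a ∉ acl (LHom.id L₀) A →
      b ∈ acl (LHom.id L₀) (insert a A)

/-- Any two `acl`-closed subsets of a model of `T₀` are independent over their intersection. For a
pregeometric theory `T₀`, this says that `acl` is a modular pregeometry. -/
def IsModular (T₀ : L₀.Theory) : Prop :=
  ∀ (M : Theory.ModelType.{u, v, max u v w} T₀) (A B : Set M),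
    acl (LHom.id L₀) A = A → acl (LHom.id L₀) B = B → Indep (LHom.id L₀) A (A ∩ B) B

/-- For `φ(y, x)` with `y` of length `m` and `x` of length `n`: the formula `θ(y)` defines, in all
models `M` of `T`, the set of tuples `b` such that `φ(b, x)` is realised in an elementary extension
of `M` by a tuple which is `acl₀`-independent over `M`. -/
def DefinesGenericity (h : L₀ →ᴸ L) (T : L.Theory) {m n : ℕ} (φ : L.Formula (Fin m ⊕ Fin n))
    (θ : L.Formula (Fin m)) : Prop :=
  ∀ (M : Theory.ModelType.{u, v, max u v w} T) (b : Fin m → M),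
    θ.Realize b ↔
      ∃ (N : Theory.ModelType.{u, v, max u v w} T) (f : M ↪ₑ[L] N) (a : Fin n → N),
        φ.Realize (Sum.elim (f ∘ b) a) ∧ IndependentOver h a (Set.range f)

/-- The `L₀`-formula `τ(y, x, t)` is algebraic in the single variable `t`: the number of
solutions `t` is bounded uniformly in the parameters. -/
def IsAlgebraicFormula (T₀ : L₀.Theory) {m n : ℕ} (τ : L₀.Formula ((Fin m ⊕ Fin n) ⊕ Unit)) :
    Prop :=
  ∃ k : ℕ, ∀ (M : Theory.ModelType.{u, v, max u v w} T₀) (c : Fin m ⊕ Fin n → M),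
    {t : M | τ.Realize (Sum.elim c fun _ => t)}.encard ≤ k

/-- The `L₀`-formula `τ(y, x, t)` is strict in `x¹`, where `x⁰` consists of the variables `x i` with
`i ∈ I` and `x¹` of those with `i ∉ I`: if `a¹` is independent over `b a⁰`, then all solutions
of `τ(b, a, t)` are in `acl₀(b a) \ acl₀(b a⁰)`. -/
def IsStrictFormula (T₀ : L₀.Theory) {m n : ℕ} (I : Set (Fin n))
    (τ : L₀.Formula ((Fin m ⊕ Fin n) ⊕ Unit)) : Prop :=
  ∀ (M : Theory.ModelType.{u, v, max u v w} T₀) (b : Fin m → M) (a : Fin n → M),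
    IndependentOver (LHom.id L₀) (fun i : {i // i ∉ I} => a i) (Set.range b ∪ a '' I) →
    ∀ t : M, τ.Realize (Sum.elim (Sum.elim b a) fun _ => t) →
      t ∈ acl (LHom.id L₀) (Set.range b ∪ Set.range a) ∧
      t ∉ acl (LHom.id L₀) (Set.range b ∪ a '' I)

/-- `T'` is a model companion of `T`: it is model complete, every model of `T` embeds in a model
of `T'`, and every model of `T'` embeds in a model of `T`. -/
def IsModelCompanion (T' T : L.Theory) : Prop :=
  IsModelComplete.{u, v, w} T' ∧
  (∀ M : Theory.ModelType.{u, v, max u v w} T,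
    ∃ N : Theory.ModelType.{u, v, max u v w} T', Nonempty (M ↪[L] N)) ∧
  (∀ M : Theory.ModelType.{u, v, max u v w} T',
    ∃ N : Theory.ModelType.{u, v, max u v w} T, Nonempty (M ↪[L] N))

/-- `M` is existentially closed in its extension `N` (along the embedding `f`): every
quantifier-free formula over `M` with a solution in `N` has a solution in `M`. -/
def IsExistentiallyClosedIn {M N : Type*} [L.Structure M] [L.Structure N] (f : M ↪[L] N) : Prop :=
  ∀ (m n : ℕ) (ψ : L.Formula (Fin m ⊕ Fin n)), ψ.IsQF → ∀ b : Fin m → M,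
    (∃ a : Fin n → N, ψ.Realize (Sum.elim (f ∘ b) a)) → ∃ a : Fin n → M, ψ.Realize (Sum.elim b a)

end Theories

/-- A single unary relation symbol. -/
inductive PredSymbol : ℕ → Type v
  | S : PredSymbol 1

/-- The language `L_S`, obtained from `L` by adding a unary predicate symbol `S`. -/
abbrev withPred (L : FirstOrder.Language.{u, v}) : FirstOrder.Language.{u, v} :=
  L.sum (⟨fun _ => PEmpty, PredSymbol⟩ : FirstOrder.Language.{u, v})

section Pairs

variable {L₀ : FirstOrder.Language.{u, v}} {L : FirstOrder.Language.{u, v}}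

/-- The symbol `S` of `L_S`. -/
def symbS (L : FirstOrder.Language.{u, v}) : (withPred L).Relations 1 := Sum.inr PredSymbol.S

/-- The inclusion of `L` in `L_S`. -/
def incl (L : FirstOrder.Language.{u, v}) : L →ᴸ withPred L := LHom.sumInl

/-- The subset of an `L_S`-structure that interprets `S`. -/
def predSet (L : FirstOrder.Language.{u, v}) (M : Type*) [(withPred L).Structure M] : Set M :=
  {x | Structure.RelMap (symbS L) ![x]}

/-- Relativisation to `S` of an `L₀`-formula: all quantifiers are restricted to `S`. -/
def relativize (h : L₀ →ᴸ L) {α : Type} : ∀ {n : ℕ},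
    L₀.BoundedFormula α n → (withPred L).BoundedFormula α n
  | _, .falsum => .falsum
  | _, .equal t₁ t₂ => .equal (((incl L).comp h).onTerm t₁) (((incl L).comp h).onTerm t₂)
  | _, .rel R ts => .rel (((incl L).comp h).onRelation R) fun i => ((incl L).comp h).onTerm (ts i)
  | _, .imp f₁ f₂ => (relativize h f₁).imp (relativize h f₂)
  | n, .all f =>
      (((symbS L).boundedFormula₁ (Term.var (Sum.inr (Fin.last n)))).imp (relativize h f)).all

/-- The sentence saying that `S` is closed under the function `f`. -/
noncomputable def closedUnder (h : L₀ →ᴸ L) {n : ℕ} (f : L₀.Functions n) : (withPred L).Sentence :=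
  Formula.iAlls (Fin n) <|
    (Formula.iInf fun i : Fin n => (symbS L).formula₁ (Term.var (Sum.inr i))).imp
      ((symbS L).formula₁
        (Term.func (((incl L).comp h).onFunction f) fun i => Term.var (Sum.inr i)))

/-- The sentence saying that `S` is non-empty. -/
noncomputable def nonemptyS (L : FirstOrder.Language.{u, v}) : (withPred L).Sentence :=
  Formula.iExs Unit ((symbS L).formula₁ (Term.var (Sum.inr ())))

/-- The theory `T_S` of pairs `(M, M₀)`, where `M` is a model of `T` and the interpretation `M₀` of
`S` is a (non-empty) substructure of the `L₀`-reduct of `M` and a model of `T₀`. -/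
def pairTheory (h : L₀ →ᴸ L) (T₀ : L₀.Theory) (T : L.Theory) : (withPred L).Theory :=
  (incl L).onTheory T ∪ {σ | ∃ (n : ℕ) (f : L₀.Functions n), σ = closedUnder h f} ∪ {nonemptyS L} ∪
    {σ | ∃ ρ ∈ T₀, σ = relativize h ρ}

/-- The sentence
`∀ y (θ(y) → ∃ x (φ(y, x) ∧ x⁰ ⊆ S ∧ ⋀_{l < k} ∀ t (τ_l(y, x, t) → t ∉ S)))`,
where `x⁰` consists of the variables `x i` with `i ∈ I`. -/
noncomputable def genericAxiom (h : L₀ →ᴸ L) {m n k : ℕ} (I : Set (Fin n))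
    (φ : L.Formula (Fin m ⊕ Fin n)) (θ : L.Formula (Fin m))
    (τ : Fin k → L₀.Formula ((Fin m ⊕ Fin n) ⊕ Unit)) : (withPred L).Sentence :=
  Formula.iAlls (Fin m) <| Formula.relabel Sum.inr <|
    ((incl L).onFormula θ).imp <| Formula.iExs (Fin n) <|
      (incl L).onFormula φ ⊓
      (Formula.iInf fun i : I => (symbS L).formula₁ (Term.var (Sum.inr (i : Fin n)))) ⊓
      (Formula.iInf fun l : Fin k => Formula.iAlls Unit <|
        (((incl L).comp h).onFormula (τ l)).imp
          (Formula.not ((symbS L).formula₁ (Term.var (Sum.inr ())))))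

/-- The axiom scheme: all `genericAxiom`s for an `L`-formula `φ(y, x)`, a partition `x = x⁰x¹`, and a
finite family of `L₀`-formulas which are algebraic in `t` and strict in `x¹`. -/
def genericScheme (h : L₀ →ᴸ L) (T₀ : L₀.Theory)
    (θ : ∀ m n : ℕ, L.Formula (Fin m ⊕ Fin n) → L.Formula (Fin m)) : (withPred L).Theory :=
  {σ | ∃ (m n k : ℕ) (I : Set (Fin n)) (φ : L.Formula (Fin m ⊕ Fin n))
      (τ : Fin k → L₀.Formula ((Fin m ⊕ Fin n) ⊕ Unit)),
      (∀ l, IsAlgebraicFormula.{u, v, w} T₀ (τ l) ∧ IsStrictFormula.{u, v, w} T₀ I (τ l)) ∧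
      σ = genericAxiom h I φ (θ m n φ) τ}

/-- The extension `(M, M₀) ⊆ (N, N₀)` given by the embedding `f` is strong: `N₀ ⫝⁰_{M₀} M`. -/
def IsStrong (h : L₀ →ᴸ L) {M N : Type*} [(withPred L).Structure M] [(withPred L).Structure N]
    (f : M ↪[withPred L] N) : Prop :=
  Indep ((incl L).comp h) (predSet L N) (f '' predSet L M) (Set.range f)

end Pairs

end ReductExpansion

/-!
Under the hypotheses, a model of `T_S` is the same as a pair: a model `M` of `T` with a
distinguished `acl₀`-closed subset, infinite unless `M` is finite (`Pair.toModel`, `Pair.ofModel`).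
Closedness of the predicate comes from model completeness of `T₀`; conversely, closed sets which are
not proper finite subsets are models of `T₀`. Since `T` is model complete, embeddings of pairs are
elementary for `L`.

**Extensions.** Strongness of an extension is handled through freeness (`IsFree`): adding the large
predicate creates no new dependencies among elements of the small model. This implies independence
in the sense of tuples, is transitive, and passes to unions of chains. Over a given pair, all
formulas `φ(b, x)` with `θ_φ(b)` are solved at once by tuples that are jointly independent over the
small model: finitely many are solved one after the other by the defining property of `θ_φ`, and all
of them by compactness (`exists_isSolution`). The new predicate is the closure of the old one
together with the coordinates in `x⁰`. It is free over the small model, and by strictness it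
contains no solution of the formulas `τ` (`exists_strongEmbedding_solving`). Iterating `ω` times and
taking the union gives a model of the axiom scheme, because algebraic formulas acquire no new
solutions in elementary extensions (`exists_strongEmbedding_scheme`).

**Existential closedness.** Let `(M, M₀) ⊆ (N, N₀)` be strong, and `c` a finite tuple in `N`. Choose
a basis `a⁰` over `M` of the part of `c` lying in `N₀`, and extend it to a basis `a⁰a¹` of `c`. A
formula over finitely many parameters certifies whether a coordinate `y` of `c` is in the predicate
(`IsCertificate`):
* if `y ∈ N₀`, then `y` is algebraic over `M₀a⁰` by strongness;
* if `y ∉ N₀` is algebraic over `Ma⁰`, then for some `Q ⊆ M` it is interdependent over `M₀Qa⁰` with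
  some `e ∈ M` that is not algebraic over `M₀Q`, whereas a copy of `y` in `M₀` would make `e`
  algebraic over `M₀Q`;
* otherwise `y` is interdependent with a coordinate of `a¹`, which gives a formula that is algebraic
  and strict in `x¹`, and the generic axiom keeps its solutions out of the predicate.

The generic axiom for the conjunction of these formulas with a given `L`-formula satisfied by `c`
yields a copy of `c` in `M` (`exists_copy`). This is enough, as the truth of a quantifier-free
formula is determined by finitely many `L`-formulas and by which of finitely many terms have values
in the predicate (`exists_determining`).

**Model companion.** If the pregeometry is modular, then every extension is strong
(`isStrong_of_isModular`), so that models of `TS` are existentially closed in their extensions to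
models of `TS`, and `TS` is model complete by Robinson's test
(`isModelComplete_of_existentiallyClosed`).
-/

namespace ReductExpansion

/-! ### Algebraic closure as a finitary closure operator -/

section Counting

variable {L : FirstOrder.Language.{u, v}} {α : Type*} {M : Type*} [L.Structure M]

/-- For a formula `ψ(y, t)`, the formula in `y, x₁, …, x_k` saying that all solutions `t` of
`ψ(y, t)` are among `x₁, …, x_k`. -/
noncomputable def coveredBy (k : ℕ) (ψ : L.Formula (α ⊕ Unit)) : L.Formula (α ⊕ Fin k) :=
  Formula.iAlls Unit ((ψ.relabel (Sum.map Sum.inl id)).imp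
    (Formula.iSup fun i : Fin k =>
      (Term.var (Sum.inl (Sum.inr i))).equal (Term.var (Sum.inr ()))))

theorem realize_coveredBy {k : ℕ} {ψ : L.Formula (α ⊕ Unit)} {v : α → M} {x : Fin k → M} :
    (coveredBy k ψ).Realize (Sum.elim v x) ↔
      ∀ t, ψ.Realize (Sum.elim v fun _ => t) → ∃ i, x i = t := by
  have key : ∀ i : Unit → M,
      (fun a => Sum.elim (Sum.elim v x) i a) ∘ Sum.map Sum.inl id = Sum.elim v fun _ => i () := by
    intro i
    funext a
    rcases a with a | a <;> rfl
  simp only [coveredBy, Formula.realize_iAlls, Formula.realize_imp, Formula.realize_relabel,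
    Formula.realize_iSup, Formula.realize_equal, Term.realize_var, Sum.elim_inl, Sum.elim_inr, key]
  exact ⟨fun H t => H fun _ => t, fun H i => H (i ())⟩

/-- The formula `ψ(y, t)` restricted to those parameters `y` for which it has at most `k`
solutions `t`. -/
noncomputable def bdd (k : ℕ) (ψ : L.Formula (α ⊕ Unit)) : L.Formula (α ⊕ Unit) :=
  ψ ⊓ (Formula.iExs (Fin k) (coveredBy k ψ)).relabel Sum.inl

theorem realize_bdd {k : ℕ} {ψ : L.Formula (α ⊕ Unit)} {v : α → M} {c : M} :
    (bdd k ψ).Realize (Sum.elim v fun _ => c) ↔ ψ.Realize (Sum.elim v fun _ => c) ∧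
      ∃ x : Fin k → M, ∀ t, ψ.Realize (Sum.elim v fun _ => t) → ∃ i, x i = t := by
  simp only [bdd, Formula.realize_inf, Formula.realize_relabel, Formula.realize_iExs,
    Sum.elim_comp_inl, realize_coveredBy]

theorem encard_bdd_le (k : ℕ) (ψ : L.Formula (α ⊕ Unit)) (v : α → M) :
    {t : M | (bdd k ψ).Realize (Sum.elim v fun _ => t)}.encard ≤ k := by
  by_cases hx : ∃ x : Fin k → M, ∀ t, ψ.Realize (Sum.elim v fun _ => t) → ∃ i, x i = t
  · obtain ⟨x, hx⟩ := hx
    have hsub : {t : M | (bdd k ψ).Realize (Sum.elim v fun _ => t)} ⊆ x '' Set.univ := by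
      intro t ht
      obtain ⟨i, hi⟩ := hx t (realize_bdd.1 ht).1
      exact ⟨i, trivial, hi⟩
    refine (Set.encard_le_encard hsub).trans ((Set.encard_image_le _ _).trans ?_)
    simp
  · have : {t : M | (bdd k ψ).Realize (Sum.elim v fun _ => t)} = ∅ := by
      ext t
      simp only [Set.mem_ofPred_eq, Set.mem_empty_iff_false, iff_false]
      exact fun ht => hx (realize_bdd.1 ht).2
    rw [this]
    simp

theorem finite_bdd (k : ℕ) (ψ : L.Formula (α ⊕ Unit)) (v : α → M) :
    {t : M | (bdd k ψ).Realize (Sum.elim v fun _ => t)}.Finite :=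
  Set.finite_of_encard_le_coe (encard_bdd_le k ψ v)

/-- If a formula has finitely many solutions, then all of them satisfy the bounded form of it. -/
theorem exists_realize_bdd {ψ : L.Formula (α ⊕ Unit)} {v : α → M}
    (hfin : {t : M | ψ.Realize (Sum.elim v fun _ => t)}.Finite) :
    ∃ k, ∀ c, ψ.Realize (Sum.elim v fun _ => c) → (bdd k ψ).Realize (Sum.elim v fun _ => c) := by
  refine ⟨hfin.toFinset.card, fun c hc => realize_bdd.2 ⟨hc, ?_⟩⟩
  refine ⟨fun i => (hfin.toFinset.equivFin.symm i : M), fun t ht => ?_⟩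
  exact ⟨hfin.toFinset.equivFin ⟨t, by simpa using ht⟩, by simp⟩

/-- The truth of a formula depends on finitely many of its variables. -/
theorem exists_finset_support (φ : L.Formula α) :
    ∃ (s : Finset α) (φ' : L.Formula s), ∀ (N : Type w) [L.Structure N] (v : α → N),
      φ'.Realize (fun a => v a) ↔ φ.Realize v := by
  classical
  refine ⟨φ.freeVarFinset, BoundedFormula.restrictFreeVar φ id, fun N _ v => ?_⟩
  exact BoundedFormula.realize_restrictFreeVar v (by simp)

end Counting

section Acl

variable {L₀ : FirstOrder.Language.{u, v}} {L : FirstOrder.Language.{u, v}} (h : L₀ →ᴸ L)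
variable {M : Type*} [L.Structure M] {α : Type*}

theorem acl_eq_acl_id [L₀.Structure M] [h.IsExpansionOn M] (A : Set M) :
    acl h A = acl (LHom.id L₀) A := by
  ext c
  simp only [acl, LHom.realize_onFormula, Set.mem_ofPred_eq]

/-- Elements algebraic over the range of `v` are exactly the solutions of bounded formulas
evaluated at `v`. -/
theorem mem_acl_range {v : α → M} {c : M} :
    c ∈ acl h (Set.range v) ↔ ∃ (k : ℕ) (ψ : L₀.Formula (α ⊕ Unit)),
      (h.onFormula (bdd k ψ)).Realize (Sum.elim v fun _ => c) := by
  let := h.reduct M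
  rw [acl_eq_acl_id]
  simp only [LHom.realize_onFormula, acl, Set.mem_ofPred_eq]
  constructor
  · rintro ⟨ψ, h1, h2⟩
    choose g hg using fun a : Set.range v => a.2
    have key : ∀ t : M, (Sum.elim v fun _ : Unit => t) ∘ Sum.map g id =
        Sum.elim (fun a : Set.range v => (a : M)) fun _ => t := by
      intro t
      funext a
      rcases a with a | a
      · exact hg a
      · rfl
    have key2 : ∀ t : M, (ψ.relabel (Sum.map g id)).Realize (Sum.elim v fun _ : Unit => t) ↔
        ψ.Realize (Sum.elim (fun a : Set.range v => (a : M)) fun _ => t) := by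
      intro t
      rw [Formula.realize_relabel, key]
    obtain ⟨k, hk⟩ := exists_realize_bdd (ψ := ψ.relabel (Sum.map g id)) (v := v)
      (by simpa only [key2] using h2)
    exact ⟨k, _, hk c ((key2 c).2 h1)⟩
  · rintro ⟨k, ψ, hc⟩
    have key : ∀ t : M, (Sum.elim (fun a : Set.range v => (a : M)) fun _ : Unit => t) ∘
        Sum.map (fun a => ⟨v a, a, rfl⟩) id = Sum.elim v fun _ => t := by
      intro t
      funext a
      rcases a with a | a <;> rfl
    refine ⟨(bdd k ψ).relabel (Sum.map (fun a => ⟨v a, a, rfl⟩) id), ?_, ?_⟩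
    · rwa [Formula.realize_relabel, key]
    · simp only [Formula.realize_relabel, key]
      exact finite_bdd k ψ v

theorem mem_acl_image {v : α → M} {J : Set α} {c : M} :
    c ∈ acl h (v '' J) ↔ ∃ (k : ℕ) (ψ : L₀.Formula (J ⊕ Unit)),
      (h.onFormula (bdd k ψ)).Realize (Sum.elim (fun j : J => v j) fun _ => c) := by
  rw [Set.image_eq_range]
  exact mem_acl_range h

theorem subset_acl (A : Set M) : A ⊆ acl h A := by
  intro c hc
  let := h.reduct M
  rw [acl_eq_acl_id]
  refine ⟨(Term.var (Sum.inl ⟨c, hc⟩)).equal (Term.var (Sum.inr ())), ?_, ?_⟩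
  · simp
  · simp

theorem acl_mono {A B : Set M} (hAB : A ⊆ B) : acl h A ⊆ acl h B := by
  intro c hc
  rw [← Subtype.range_coe (s := A), mem_acl_range] at hc
  obtain ⟨k, ψ, hc⟩ := hc
  let := h.reduct M
  rw [LHom.realize_onFormula] at hc
  have key : ∀ t : M, (Sum.elim (fun a : B => (a : M)) fun _ : Unit => t) ∘
      Sum.map (Set.inclusion hAB) id = Sum.elim (fun a : A => (a : M)) fun _ => t := by
    intro t
    funext a
    rcases a with a | a <;> rfl
  refine ⟨(bdd k ψ).relabel (Sum.map (Set.inclusion hAB) id), ?_, ?_⟩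
  · rw [LHom.realize_onFormula, Formula.realize_relabel, key]
    exact hc
  · simp only [LHom.realize_onFormula, Formula.realize_relabel, key]
    exact finite_bdd k ψ _

theorem acl_finitary {A : Set M} {c : M} (hc : c ∈ acl h A) :
    ∃ F ⊆ A, F.Finite ∧ c ∈ acl h F := by
  classical
  rw [← Subtype.range_coe (s := A), mem_acl_range] at hc
  obtain ⟨k, ψ, hc⟩ := hc
  let := h.reduct M
  rw [LHom.realize_onFormula] at hc
  obtain ⟨s, ψ', hs⟩ := exists_finset_support (bdd k ψ)
  let F : Set M := {x | ∃ a : A, Sum.inl a ∈ s ∧ (a : M) = x}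
  have hF : F.Finite := by
    refine ((s.finite_toSet.image
      (Sum.elim (fun a : A => (a : M)) fun _ : Unit => c))).subset ?_
    rintro x ⟨a, ha, rfl⟩
    exact ⟨Sum.inl a, ha, rfl⟩
  let r : s → F ⊕ Unit := fun x => match x with
    | ⟨Sum.inl a, ha⟩ => Sum.inl ⟨a, a, ha, rfl⟩
    | ⟨Sum.inr _, _⟩ => Sum.inr ()
  have key : ∀ t : M, (Sum.elim (fun a : F => (a : M)) fun _ : Unit => t) ∘ r =
      fun a : s => Sum.elim (fun a : A => (a : M)) (fun _ => t) a.1 := by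
    intro t
    funext a
    rcases a with ⟨a | a, ha⟩ <;> rfl
  refine ⟨F, ?_, hF, ψ'.relabel r, ?_, ?_⟩
  · rintro x ⟨a, -, rfl⟩
    exact a.2
  · rw [LHom.realize_onFormula, Formula.realize_relabel, key, hs]
    exact hc
  · simp only [LHom.realize_onFormula, Formula.realize_relabel, key, hs]
    exact finite_bdd k ψ _

theorem acl_idem {A : Set M} : acl h (acl h A) ⊆ acl h A := by
  intro c hc
  obtain ⟨F, hFA, hF, hc⟩ := acl_finitary h hc
  have := hF.to_subtype
  rw [← Subtype.range_coe (s := F), mem_acl_range] at hc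
  obtain ⟨l, ρ, hc⟩ := hc
  have hx : ∀ x : F, ∃ (k : ℕ) (ψ : L₀.Formula (A ⊕ Unit)),
      (h.onFormula (bdd k ψ)).Realize (Sum.elim (fun a : A => (a : M)) fun _ => (x : M)) := by
    intro x
    have := hFA x.2
    rwa [← Subtype.range_coe (s := A), mem_acl_range] at this
  choose k ψ hψ using hx
  let := h.reduct M
  simp only [LHom.realize_onFormula] at hc hψ
  -- Algebraicity of `c` over `F`, with the elements of `F` quantified among the finitely many
  -- solutions of the bounded formulas defining them.
  let χ : L₀.Formula (A ⊕ Unit) := Formula.iExs F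
    ((Formula.iInf fun x : F => (bdd (k x) (ψ x)).relabel
        (Sum.elim (fun a => Sum.inl (Sum.inl a)) fun _ => Sum.inr x)) ⊓
      (bdd l ρ).relabel (Sum.elim Sum.inr fun _ => Sum.inl (Sum.inr ())))
  have hχ : ∀ t : M, χ.Realize (Sum.elim (fun a : A => (a : M)) fun _ => t) ↔
      ∃ y : F → M, (∀ x, (bdd (k x) (ψ x)).Realize
          (Sum.elim (fun a : A => (a : M)) fun _ => y x)) ∧
        (bdd l ρ).Realize (Sum.elim y fun _ => t) := by
    intro t
    simp only [χ, Formula.realize_iExs, Formula.realize_inf, Formula.realize_iInf,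
      Formula.realize_relabel]
    refine exists_congr fun y => and_congr (forall_congr' fun x => ?_) ?_
    · refine iff_of_eq (congrArg _ (funext fun a => ?_))
      rcases a with a | a <;> rfl
    · refine iff_of_eq (congrArg _ (funext fun a => ?_))
      rcases a with a | a <;> rfl
  refine ⟨χ, ?_, ?_⟩
  · rw [LHom.realize_onFormula, hχ]
    exact ⟨fun x => x, hψ, hc⟩
  · simp only [LHom.realize_onFormula, hχ]
    refine ((Set.Finite.pi' fun x : F => finite_bdd (k x) (ψ x)
      (fun a : A => (a : M))).biUnion fun y _ => finite_bdd l ρ y).subset ?_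
    rintro t ⟨y, hy, ht⟩
    exact Set.mem_biUnion (x := y) hy ht

variable {N : Type*} [L.Structure N]

/-- Algebraic closure is absolute: a bounded formula has no new solutions in an elementary
extension, as it is part of the type of the parameters that its solutions are among `k` given
elements. -/
theorem acl_image_elementary (g : M ↪ₑ[L] N) (A : Set M) : acl h (g '' A) = g '' acl h A := by
  let := h.reduct M
  let := h.reduct N
  have hgen : ∀ {β : Type _} (φ : L₀.Formula β) (v : β → M),
      φ.Realize (g ∘ v) ↔ φ.Realize v := by
    intro β φ v
    rw [← LHom.realize_onFormula h, ← LHom.realize_onFormula h, g.map_formula]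
  have helim : ∀ {β γ : Type _} (v : β → M) (x : γ → M),
      Sum.elim (fun a => g (v a)) (fun i => g (x i)) = g ∘ Sum.elim v x := by
    intro β γ v x
    funext a
    rcases a with a | a <;> rfl
  ext c
  rw [Set.image_eq_range, mem_acl_range]
  constructor
  · rintro ⟨k, ψ, hc⟩
    rw [LHom.realize_onFormula] at hc
    have hex := (realize_bdd.1 hc).2
    simp only [← realize_coveredBy] at hex
    rw [← Formula.realize_iExs] at hex
    rw [show (fun x : A => g x) = g ∘ (fun x : A => (x : M)) from rfl, hgen,
      Formula.realize_iExs] at hex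
    obtain ⟨x, hx⟩ := hex
    have hx' := hx
    rw [← hgen, ← helim, realize_coveredBy] at hx'
    obtain ⟨i, rfl⟩ := hx' c (realize_bdd.1 hc).1
    refine ⟨x i, ?_, rfl⟩
    rw [← Subtype.range_coe (s := A), mem_acl_range]
    refine ⟨k, ψ, ?_⟩
    rw [LHom.realize_onFormula, ← hgen, ← helim]
    exact hc
  · rintro ⟨d, hd, rfl⟩
    rw [← Subtype.range_coe (s := A), mem_acl_range] at hd
    obtain ⟨k, ψ, hd⟩ := hd
    rw [LHom.realize_onFormula, ← hgen, ← helim] at hd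
    refine ⟨k, ψ, ?_⟩
    rwa [LHom.realize_onFormula]

theorem mem_acl_elementary (g : M ↪ₑ[L] N) {A : Set M} {c : M} :
    g c ∈ acl h (g '' A) ↔ c ∈ acl h A := by
  rw [acl_image_elementary, g.injective.mem_set_image]

end Acl

/-! ### Pregeometries and independence -/

section Pregeometry

variable {M : Type*} {ι : Type*}

/-- The operator `cl` is a pregeometry: a finitary closure operator with the exchange property. -/
structure IsPregeometry (cl : Set M → Set M) : Prop where
  subset : ∀ A, A ⊆ cl A
  mono : ∀ {A B}, A ⊆ B → cl A ⊆ cl B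
  idem : ∀ {A}, cl (cl A) ⊆ cl A
  finitary : ∀ {A c}, c ∈ cl A → ∃ F ⊆ A, F.Finite ∧ c ∈ cl F
  exchange : ∀ {A a b}, a ∈ cl (insert b A) → a ∉ cl A → b ∈ cl (insert a A)

/-- The subfamily `(a j)`, `j ∈ J`, is independent over `D` in the pregeometry `cl`. -/
def IndepOn (cl : Set M → Set M) (a : ι → M) (J : Set ι) (D : Set M) : Prop :=
  ∀ j ∈ J, a j ∉ cl (D ∪ a '' (J \ {j}))

/-- The set `B` is free from `S` over `C`: adding `S` to `C` creates no new dependencies between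
elements of `B`. For `C ⊆ S ∩ B` this is independence of `S` and `B` over `C`, in a form which is
visibly transitive and preserved under unions of chains. -/
def IsFree (cl : Set M → Set M) (S C B : Set M) : Prop :=
  ∀ D ⊆ B, ∀ c ∈ B, c ∈ cl (S ∪ D) → c ∈ cl (C ∪ D)

namespace IsPregeometry

variable {cl : Set M → Set M} (hcl : IsPregeometry cl)
include hcl

theorem cl_subset_cl {A B : Set M} (hAB : A ⊆ cl B) : cl A ⊆ cl B :=
  (hcl.mono hAB).trans hcl.idem

theorem cl_union_subset {A B C : Set M} (hA : A ⊆ cl C) (hB : B ⊆ cl C) : cl (A ∪ B) ⊆ cl C :=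
  hcl.cl_subset_cl (Set.union_subset hA hB)

theorem cl_insert_subset {A : Set M} {c : M} (hc : c ∈ cl A) : cl (insert c A) ⊆ cl A :=
  hcl.cl_subset_cl (Set.insert_subset hc (hcl.subset A))

theorem finitary_right {A B : Set M} {c : M} (hc : c ∈ cl (A ∪ B)) :
    ∃ F ⊆ B, F.Finite ∧ c ∈ cl (A ∪ F) := by
  obtain ⟨G, hG, hfin, hc⟩ := hcl.finitary hc
  refine ⟨G ∩ B, Set.inter_subset_right, hfin.inter_of_left B, hcl.mono ?_ hc⟩
  intro x hx
  rcases hG hx with h | h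
  · exact Or.inl h
  · exact Or.inr ⟨hx, h⟩

/-- If `c` depends on `A ∪ B` but not on `A`, then some `e ∈ B` is interdependent with `c` over
`A` and finitely many other elements of `B`. -/
theorem exists_interdependent {A B : Set M} {c : M} (hc : c ∈ cl (A ∪ B)) (hA : c ∉ cl A) :
    ∃ Q ⊆ B, ∃ e ∈ B, e ∈ cl (insert c (A ∪ Q)) ∧ e ∉ cl (A ∪ Q) := by
  obtain ⟨F, hFB, hF, hc⟩ := hcl.finitary_right hc
  have : ∃ Q ⊆ F, ∃ e ∈ F, c ∈ cl (insert e (A ∪ Q)) ∧ c ∉ cl (A ∪ Q) := by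
    clear hFB
    induction F, hF using Set.Finite.induction_on with
    | empty => exact absurd (by simpa using hc) hA
    | @insert e Q _ _ ih =>
      by_cases h : c ∈ cl (A ∪ Q)
      · obtain ⟨Q', hQ', e', he', h1⟩ := ih h
        exact ⟨Q', hQ'.trans (Set.subset_insert _ _), e', Set.mem_insert_of_mem _ he', h1⟩
      · exact ⟨Q, Set.subset_insert _ _, e, Set.mem_insert _ _, by
          rwa [Set.union_insert] at hc, h⟩
  obtain ⟨Q, hQ, e, he, h1, h2⟩ := this
  refine ⟨Q, hQ.trans hFB, e, hFB he, hcl.exchange h1 h2, fun h => h2 ?_⟩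
  exact hcl.cl_insert_subset h h1

/-- A family which is independent over `D` can be dropped from the dependence of an element of
`cl D` on a subset of `D`. -/
theorem mem_of_mem_union_image {a : ι → M} {J : Set ι} {D E : Set M} {c : M}
    (ha : IndepOn cl a J D) (hE : E ⊆ cl D) (hc : c ∈ cl D) (h : c ∈ cl (E ∪ a '' J)) :
    c ∈ cl E := by
  by_contra hcE
  obtain ⟨Q, hQ, e, ⟨j, hj, rfl⟩, h1, h2⟩ := hcl.exists_interdependent h hcE
  refine ha j hj (hcl.cl_subset_cl ?_ h1)
  refine Set.insert_subset (hcl.mono Set.subset_union_left hc) (Set.union_subset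
    (hE.trans (hcl.mono Set.subset_union_left)) fun x hx => ?_)
  obtain ⟨i, hi, rfl⟩ := hQ hx
  refine hcl.subset _ (Or.inr ⟨i, ⟨hi, fun hij => h2 ?_⟩, rfl⟩)
  rw [Set.mem_singleton_iff] at hij
  subst hij
  exact hcl.subset _ (Or.inr hx)

theorem indepOn_mono {a : ι → M} {J K : Set ι} {D E : Set M} (ha : IndepOn cl a J D) (hK : K ⊆ J)
    (hE : E ⊆ cl D) : IndepOn cl a K E := by
  intro j hj h
  refine ha j (hK hj) (hcl.cl_union_subset (hE.trans (hcl.mono Set.subset_union_left)) ?_ h)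
  refine Set.Subset.trans ?_ (hcl.subset _)
  exact (Set.image_mono (Set.sdiff_subset_sdiff_left hK)).trans Set.subset_union_right

/-- Closures of subfamilies of an independent family meet in the closure of the common part. -/
theorem mem_inter_of_indepOn {a : ι → M} {J K₁ K₂ : Set ι} {D E : Set M} {c : M}
    (ha : IndepOn cl a J D) (h₁ : K₁ ⊆ J) (h₂ : K₂ ⊆ J) (hE : E ⊆ cl D)
    (hc₁ : c ∈ cl (D ∪ a '' K₁)) (hc₂ : c ∈ cl (E ∪ a '' K₂)) :
    c ∈ cl (E ∪ a '' (K₂ ∩ K₁)) := by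
  have hind : IndepOn cl a (K₂ \ K₁) (D ∪ a '' K₁) := by
    intro j hj h
    refine ha j (h₂ hj.1) (hcl.mono ?_ h)
    rw [Set.union_assoc, ← Set.image_union]
    refine Set.union_subset_union_right _ (Set.image_mono ?_)
    rintro i (hi | hi)
    · exact ⟨h₁ hi, fun hij => hj.2 (by rwa [Set.mem_singleton_iff.1 hij] at hi)⟩
    · exact ⟨h₂ hi.1.1, hi.2⟩
  refine hcl.mem_of_mem_union_image hind ?_ hc₁ (hcl.mono ?_ hc₂)
  · refine Set.union_subset (hE.trans (hcl.mono Set.subset_union_left)) ?_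
    exact ((Set.image_mono Set.inter_subset_right).trans Set.subset_union_right).trans
      (hcl.subset _)
  · rw [Set.union_assoc, ← Set.image_union, Set.inter_union_sdiff]

theorem indepOn_insert {a : ι → M} {J : Set ι} {D : Set M} {i : ι} (ha : IndepOn cl a J D)
    (hi : a i ∉ cl (D ∪ a '' J)) : IndepOn cl a (insert i J) D := by
  have hiJ : i ∉ J := fun h => hi (hcl.subset _ (Or.inr ⟨i, h, rfl⟩))
  intro j hj hmem
  rcases eq_or_ne j i with rfl | hji
  · refine hi (hcl.mono (Set.union_subset_union_right _ (Set.image_mono ?_)) hmem)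
    rintro x ⟨hx | hx, hne⟩
    · exact absurd hx hne
    · exact hx
  · have hjJ : j ∈ J := hj.resolve_left hji
    have hset : insert i J \ {j} = insert i (J \ {j}) := by
      rw [Set.insert_sdiff_of_notMem]
      simpa using hji.symm
    rw [hset, Set.image_insert_eq, Set.union_insert] at hmem
    refine hi (hcl.mono ?_ (hcl.exchange hmem (ha j hjJ)))
    refine Set.insert_subset (Or.inr ⟨j, hjJ, rfl⟩) ?_
    exact Set.union_subset_union_right _ (Set.image_mono Set.sdiff_subset)

/-- Every independent subfamily of a finite family extends to a basis. -/
theorem exists_basis [Finite ι] {a : ι → M} {I A : Set ι} {D : Set M} (hI : IndepOn cl a I D)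
    (hIA : I ⊆ A) :
    ∃ K, I ⊆ K ∧ K ⊆ A ∧ IndepOn cl a K D ∧ ∀ z ∈ A, a z ∈ cl (D ∪ a '' K) := by
  obtain ⟨K, hIK, hK⟩ := (Set.toFinite {K : Set ι | K ⊆ A ∧ IndepOn cl a K D}).exists_le_maximal
    (a := I) ⟨hIA, hI⟩
  refine ⟨K, hIK, hK.prop.1, hK.prop.2, fun z hz => ?_⟩
  by_contra hmem
  have := hK.le_of_ge (y := insert z K) ⟨Set.insert_subset hz hK.prop.1,
    hcl.indepOn_insert hK.prop.2 hmem⟩ (Set.subset_insert _ _)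
  exact hmem (hcl.subset _ (Or.inr ⟨z, this (Set.mem_insert _ _), rfl⟩))

/-- Freeness implies independence in the sense of tuples. -/
theorem not_mem_of_isFree {S C B A : Set M} {c : M} (hfree : IsFree cl S C B) (hCS : C ⊆ S)
    (hA : A ⊆ S) (hc : c ∈ S) (h : c ∉ cl (C ∪ A)) : c ∉ cl (C ∪ B ∪ A) := by
  intro hmem
  rw [Set.union_right_comm] at hmem
  obtain ⟨Q, hQ, e, he, h1, h2⟩ := hcl.exists_interdependent hmem h
  refine h2 (hcl.mono ?_ (hfree Q hQ e he (hcl.mono ?_ h1)))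
  · exact Set.union_subset_union_left _ Set.subset_union_left
  · refine Set.insert_subset (Or.inl hc) (Set.union_subset_union_left _ ?_)
    exact Set.union_subset hCS hA

end IsPregeometry

end Pregeometry

section Models

variable {L₀ : FirstOrder.Language.{u, v}} {L : FirstOrder.Language.{u, v}} {h : L₀ →ᴸ L}
  {T₀ : L₀.Theory} {T : L.Theory}

theorem isPregeometry_id (H3 : IsPregeometric.{u, v, w} T₀)
    (M : Theory.ModelType.{u, v, max u v w} T₀) :
    IsPregeometry (acl (LHom.id L₀) : Set M → Set M) where
  subset := subset_acl _
  mono := acl_mono _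
  idem := fun hx => acl_idem _ hx
  finitary := acl_finitary _
  exchange h1 h2 := H3 M _ _ _ h1 h2

/-- The `L₀`-reduct of a model of `T`, as a model of the reduct `T₀` of `T`. -/
def reductModel (h_red : IsReduct h T₀ T) (M : Theory.ModelType.{u, v, max u v w} T) :
    Theory.ModelType.{u, v, max u v w} T₀ :=
  letI := h.reduct M
  haveI : (M : Type (max u v w)) ⊨ T₀ := (Theory.model_iff _).2 fun σ hσ => by
    rw [← LHom.realize_onSentence M h]
    exact ((h_red σ).1 (Theory.models_sentence_of_mem hσ)).realize_sentence M
  Theory.ModelType.of T₀ M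

theorem acl_reductModel (h_red : IsReduct h T₀ T) (M : Theory.ModelType.{u, v, max u v w} T)
    (A : Set M) : acl h A = acl (M := reductModel h_red M) (LHom.id L₀) A :=
  letI := h.reduct M
  acl_eq_acl_id h A

theorem isPregeometry_acl (h_red : IsReduct h T₀ T) (H3 : IsPregeometric.{u, v, w} T₀)
    (M : Theory.ModelType.{u, v, max u v w} T) :
    IsPregeometry (acl h : Set M → Set M) := by
  have := isPregeometry_id H3 (reductModel h_red M)
  rwa [← show (acl h : Set M → Set M) = acl (M := reductModel h_red M) (LHom.id L₀) from
    funext (acl_reductModel h_red M)] at this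

/-- The strictness property of a formula, read in the models of `T`. -/
theorem IsStrictFormula.spec (h_red : IsReduct h T₀ T) {m n : ℕ} {I : Set (Fin n)}
    {τ : L₀.Formula ((Fin m ⊕ Fin n) ⊕ Unit)} (hτ : IsStrictFormula.{u, v, w} T₀ I τ)
    (M : Theory.ModelType.{u, v, max u v w} T) (b : Fin m → M) (a : Fin n → M)
    (ha : IndependentOver h (fun i : {i // i ∉ I} => a i) (Set.range b ∪ a '' I)) {t : M}
    (ht : (h.onFormula τ).Realize (Sum.elim (Sum.elim b a) fun _ => t)) :
    t ∈ acl h (Set.range b ∪ Set.range a) ∧ t ∉ acl h (Set.range b ∪ a '' I) := by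
  let := h.reduct M
  rw [LHom.realize_onFormula] at ht
  simp only [acl_reductModel h_red M]
  refine hτ (reductModel h_red M) b a (fun i hi => ha i ?_) t ht
  rw [acl_reductModel h_red M]
  exact hi

end Models

/-! ### Models of the theory of pairs -/

section Pairs

variable {L₀ : FirstOrder.Language.{u, v}} {L : FirstOrder.Language.{u, v}} {h : L₀ →ᴸ L}
  {T₀ : L₀.Theory} {T : L.Theory}

theorem acl_comp_incl {N : Type*} [(withPred L).Structure N] [L.Structure N]
    [(incl L).IsExpansionOn N] (A : Set N) : acl ((incl L).comp h) A = acl h A := by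
  let := h.reduct N
  have : ((incl L).comp h).IsExpansionOn N :=
    ⟨fun f x => ((incl L).map_onFunction (h.onFunction f) x).trans (h.map_onFunction f x),
      fun R x => ((incl L).map_onRelation (h.onRelation R) x).trans (h.map_onRelation R x)⟩
  exact (acl_eq_acl_id _ A).trans (acl_eq_acl_id h A).symm

theorem realize_symbS {N : Type*} [(withPred L).Structure N] {α : Type*} {n : ℕ} {v : α → N}
    {xs : Fin n → N} (t : (withPred L).Term (α ⊕ Fin n)) :
    ((symbS L).boundedFormula₁ t).Realize v xs ↔ t.realize (Sum.elim v xs) ∈ predSet L N :=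
  BoundedFormula.realize_rel₁

theorem realize_symbS_formula {N : Type*} [(withPred L).Structure N] {α : Type*} {v : α → N}
    (t : (withPred L).Term α) :
    ((symbS L).formula₁ t).Realize v ↔ t.realize v ∈ predSet L N :=
  Formula.realize_rel₁

/-- Relativised formulas are evaluated in the substructure with universe `S`. -/
theorem realize_relativize {N : Type*} [L₀.Structure N] [(withPred L).Structure N]
    [((incl L).comp h).IsExpansionOn N] (P : L₀.Substructure N)
    (hP : (P : Set N) = predSet L N) {α : Type} {n : ℕ} (φ : L₀.BoundedFormula α n) (v : α → P)
    (xs : Fin n → P) :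
    (relativize h φ).Realize (fun a => (v a : N)) (fun i => (xs i : N)) ↔ φ.Realize v xs := by
  have hterm : ∀ {n : ℕ} (xs : Fin n → P) (t : L₀.Term (α ⊕ Fin n)),
      (((incl L).comp h).onTerm t).realize
        (Sum.elim (fun a => (v a : N)) fun i => (xs i : N)) = (t.realize (Sum.elim v xs) : P) := by
    intro n xs t
    rw [LHom.realize_onTerm, ← P.coe_subtype, ← HomClass.realize_term]
    refine congrArg (fun w => t.realize w) (funext fun a => ?_)
    rcases a with a | a <;> rfl
  induction φ with
  | falsum => rfl
  | equal t₁ t₂ =>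
    refine Iff.trans (b := _ = _) Iff.rfl ?_
    rw [hterm, hterm, Subtype.coe_inj]
    rfl
  | rel R ts =>
    refine Iff.trans (b := Structure.RelMap _ _) Iff.rfl ?_
    simp only [hterm, LHom.map_onRelation]
    rfl
  | imp _ _ ih₁ ih₂ => exact imp_congr (ih₁ xs) (ih₂ xs)
  | @all n φ ih =>
    simp only [relativize, BoundedFormula.realize_all, BoundedFormula.realize_imp, realize_symbS,
      Term.realize_var, Sum.elim_inr, Fin.snoc_last]
    have hsnoc : ∀ y : P, Fin.snoc (α := fun _ => N) (fun i => (xs i : N)) (y : N) =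
        fun i => ((Fin.snoc (α := fun _ => P) xs y i : P) : N) := by
      intro y
      funext i
      refine Fin.lastCases ?_ (fun i => ?_) i <;> simp
    constructor
    · intro H y
      have := H y (hP ▸ y.2)
      rw [hsnoc] at this
      exact (ih _).1 this
    · intro H y hy
      rw [← hP] at hy
      have := H ⟨y, hy⟩
      rw [hsnoc ⟨y, hy⟩]
      exact (ih _).2 this

theorem realize_closedUnder {N : Type*} [L₀.Structure N] [(withPred L).Structure N]
    [((incl L).comp h).IsExpansionOn N] {n : ℕ} (f : L₀.Functions n) :
    N ⊨ closedUnder h f ↔ ∀ x : Fin n → N, (∀ i, x i ∈ predSet L N) →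
      Structure.funMap f x ∈ predSet L N := by
  simp only [closedUnder, Sentence.Realize, Formula.realize_iAlls, Formula.realize_imp,
    Formula.realize_iInf, realize_symbS_formula, Term.realize_var, Term.realize_func,
    Sum.elim_inr, LHom.map_onFunction]

theorem realize_nonemptyS {N : Type*} [(withPred L).Structure N] :
    N ⊨ nonemptyS L ↔ (predSet L N).Nonempty := by
  simp only [nonemptyS, Sentence.Realize, Formula.realize_iExs, realize_symbS_formula,
    Term.realize_var, Sum.elim_inr]
  exact ⟨fun ⟨i, hi⟩ => ⟨_, hi⟩, fun ⟨x, hx⟩ => ⟨fun _ => x, hx⟩⟩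

theorem model_pairTheory_iff {N : Type*} [L₀.Structure N] [L.Structure N]
    [(withPred L).Structure N] [(incl L).IsExpansionOn N]
    [((incl L).comp h).IsExpansionOn N] :
    N ⊨ pairTheory h T₀ T ↔ N ⊨ T ∧ ∃ P : L₀.Substructure N, (P : Set N) = predSet L N ∧
      Nonempty P ∧ P ⊨ T₀ := by
  have hrel : ∀ (P : L₀.Substructure N), (P : Set N) = predSet L N → ∀ ρ : L₀.Sentence,
      N ⊨ relativize h ρ ↔ P ⊨ ρ := by
    intro P hP ρ
    have := realize_relativize (h := h) P hP ρ default default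
    rw [Sentence.Realize, Formula.Realize, Sentence.Realize, Formula.Realize, ← this]
    refine iff_of_eq (congrArg₂ _ (funext fun i => ?_) (funext fun i => ?_))
    · exact i.elim
    · exact i.elim0
  simp only [pairTheory, Theory.model_union_iff, Theory.model_singleton_iff, realize_nonemptyS,
    LHom.onTheory_model]
  constructor
  · rintro ⟨⟨⟨hT, hcl⟩, hne⟩, hT₀⟩
    let P : L₀.Substructure N := ⟨predSet L N, fun f x hx =>
      (realize_closedUnder f).1 (hcl.realize_of_mem _ ⟨_, f, rfl⟩) x hx⟩
    refine ⟨hT, P, rfl, hne.to_subtype, (Theory.model_iff _).2 fun ρ hρ => ?_⟩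
    exact (hrel P rfl ρ).1 (hT₀.realize_of_mem _ ⟨ρ, hρ, rfl⟩)
  · rintro ⟨hT, P, hP, hne, hT₀⟩
    refine ⟨⟨⟨hT, (Theory.model_iff _).2 ?_⟩, ?_⟩, (Theory.model_iff _).2 ?_⟩
    · rintro _ ⟨n, f, rfl⟩
      rw [realize_closedUnder, ← hP]
      exact fun x hx => P.fun_mem f x hx
    · rw [← hP]
      exact Set.nonempty_coe_sort.1 hne
    · rintro _ ⟨ρ, hρ, rfl⟩
      exact (hrel P hP ρ).2 (hT₀.realize_of_mem _ hρ)

/-- The meaning of the axiom scheme in an `L`-structure `N` whose predicate is interpreted by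
`S`. -/
def SatisfiesScheme (h : L₀ →ᴸ L) (T₀ : L₀.Theory)
    (θ : ∀ m n : ℕ, L.Formula (Fin m ⊕ Fin n) → L.Formula (Fin m)) {N : Type*} [L.Structure N]
    (S : Set N) : Prop :=
  ∀ (m n k : ℕ) (I : Set (Fin n)) (φ : L.Formula (Fin m ⊕ Fin n))
    (τ : Fin k → L₀.Formula ((Fin m ⊕ Fin n) ⊕ Unit)),
    (∀ l, IsAlgebraicFormula.{u, v, w} T₀ (τ l) ∧ IsStrictFormula.{u, v, w} T₀ I (τ l)) →
    ∀ b : Fin m → N, (θ m n φ).Realize b →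
      ∃ a : Fin n → N, φ.Realize (Sum.elim b a) ∧ (∀ i ∈ I, a i ∈ S) ∧
        ∀ l t, (h.onFormula (τ l)).Realize (Sum.elim (Sum.elim b a) fun _ => t) → t ∉ S

theorem model_genericScheme_iff
    {θ : ∀ m n : ℕ, L.Formula (Fin m ⊕ Fin n) → L.Formula (Fin m)} {N : Type*}
    [L.Structure N] [(withPred L).Structure N] [(incl L).IsExpansionOn N] :
    N ⊨ genericScheme.{u, v, w} h T₀ θ ↔
      SatisfiesScheme.{u, v, w} h T₀ θ (predSet L N) := by
  have key : ∀ {m n k : ℕ} (I : Set (Fin n)) (φ : L.Formula (Fin m ⊕ Fin n))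
      (τ : Fin k → L₀.Formula ((Fin m ⊕ Fin n) ⊕ Unit)),
      N ⊨ genericAxiom h I φ (θ m n φ) τ ↔ ∀ b : Fin m → N, (θ m n φ).Realize b →
        ∃ a : Fin n → N, φ.Realize (Sum.elim b a) ∧ (∀ i ∈ I, a i ∈ predSet L N) ∧
        ∀ l t, (h.onFormula (τ l)).Realize (Sum.elim (Sum.elim b a) fun _ => t) →
          t ∉ predSet L N := by
    intro m n k I φ τ
    let := h.reduct N
    have : ((incl L).comp h).IsExpansionOn N :=
      ⟨fun f x => ((incl L).map_onFunction (h.onFunction f) x).trans (h.map_onFunction f x),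
        fun R x => ((incl L).map_onRelation (h.onRelation R) x).trans (h.map_onRelation R x)⟩
    rw [genericAxiom, Sentence.Realize, Formula.realize_iAlls]
    refine forall_congr' fun b => ?_
    simp only [Formula.realize_relabel, Formula.realize_imp, LHom.realize_onFormula,
      Formula.realize_iExs, Formula.realize_inf, Formula.realize_iInf, Formula.realize_iAlls,
      realize_symbS_formula, Term.realize_var, Sum.elim_inr, Formula.realize_not]
    refine imp_congr Iff.rfl (exists_congr fun a => ?_)
    rw [and_assoc]
    refine and_congr Iff.rfl (and_congr ⟨fun H i hi => H ⟨i, hi⟩, fun H i => H i i.2⟩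
      (forall_congr' fun l => ⟨fun H t => H fun _ => t, fun H i => H (i ())⟩))
  constructor
  · intro H m n k I φ τ hτ
    exact (key I φ τ).1 (H.realize_of_mem _ ⟨m, n, k, I, φ, τ, hτ, rfl⟩)
  · intro H
    refine (Theory.model_iff _).2 ?_
    rintro _ ⟨m, n, k, I, φ, τ, hτ, rfl⟩
    exact (key I φ τ).2 (H m n k I φ τ hτ)

/-- A model of a model complete theory is an elementary substructure of all models extending
it. -/
def elementaryOfModelComplete (H1 : IsModelComplete.{u, v, w} T)
    {M N : Theory.ModelType.{u, v, max u v w} T} (f : M ↪[L] N) : M ↪ₑ[L] N :=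
  ⟨f, fun n ψ x => H1 M N f n ψ x⟩

theorem finite_of_elementary {M N : Type*} [L.Structure M] [L.Structure N] (f : M ↪ₑ[L] N)
    [Nonempty M] [Finite M] : Finite N := by
  obtain ⟨c⟩ := ‹Nonempty M›
  obtain ⟨k, hk⟩ := exists_realize_bdd (M := M) (ψ := (⊤ : L.Formula (Empty ⊕ Unit)))
    (v := Empty.elim) (Set.toFinite _)
  have := (f.map_formula _ _).2 (hk c (by simp))
  rw [show f ∘ Sum.elim Empty.elim (fun _ : Unit => c) = Sum.elim Empty.elim fun _ => f c from
    funext (by rintro (a | a); exacts [a.elim, rfl]), realize_bdd] at this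
  obtain ⟨-, x, hx⟩ := this
  exact Finite.of_surjective x fun t => hx t (by simp)

/-- A model of `T` with a distinguished `acl`-closed subset, which is infinite unless the model
itself is finite. Under the hypotheses of the theorem, these are the models of `pairTheory`. -/
structure Pair (h : L₀ →ᴸ L) (T : L.Theory) where
  /-- the underlying model of `T` -/
  model : Theory.ModelType.{u, v, max u v w} T
  /-- the distinguished subset -/
  S : Set model
  closed : acl h S ⊆ S
  infinite : S.Infinite ∨ Finite model

/-- The structure in the language of a single predicate which interprets it by `S`. -/
abbrev predStructure {N : Type*} (S : Set N) :
    (⟨fun _ => PEmpty, PredSymbol⟩ : FirstOrder.Language.{u, v}).Structure N where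
  funMap f := f.elim
  RelMap R := match R with
    | PredSymbol.S => fun x => x 0 ∈ S

/-- An `acl`-closed subset of a model of `T₀` which is not a proper finite subset is the universe
of a model of `T₀`. -/
theorem exists_substructure_model (H2 : InfiniteAclModels.{u, v, w} T₀)
    (M : Theory.ModelType.{u, v, max u v w} T₀) {S : Set M}
    (hS : acl (LHom.id L₀) S ⊆ S) (hinf : S.Infinite ∨ Finite M) :
    ∃ P : L₀.Substructure M, (P : Set M) = S ∧ Nonempty P ∧ P ⊨ T₀ := by
  rcases hinf with hinf | hfin
  · obtain ⟨P, hP, hP'⟩ := H2 M S hinf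
    have hPS : (P : Set M) = S := hP.trans (hS.antisymm (subset_acl _ _))
    refine ⟨P, hPS, ?_, hP'⟩
    obtain ⟨x, hx⟩ := hinf.nonempty
    exact ⟨x, by rwa [← SetLike.mem_coe, hPS]⟩
  · have hS' : S = Set.univ := by
      refine Set.eq_univ_of_forall fun x => hS ?_
      exact ⟨⊤, by simp, Set.toFinite _⟩
    refine ⟨⊤, by simp [hS'], ?_, ?_⟩
    · obtain ⟨x⟩ := M.nonempty'
      exact ⟨x, trivial⟩
    · exact StrongHomClass.theory_model (Substructure.topEquiv (L := L₀) (M := M)).symm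

/-- The model of `pairTheory` given by a pair. -/
noncomputable def Pair.toModel (h_red : IsReduct h T₀ T) (H2 : InfiniteAclModels.{u, v, w} T₀)
    (M : Pair.{u, v, w} h T) : Theory.ModelType.{u, v, max u v w} (pairTheory h T₀ T) :=
  letI := predStructure M.S
  letI : (withPred L).Structure M.model := Language.sumStructure _ _ _
  haveI : (M.model : Type _) ⊨ pairTheory h T₀ T := by
    let := h.reduct M.model
    have : (incl L).IsExpansionOn M.model := LHom.sumInl_isExpansionOn _
    have : ((incl L).comp h).IsExpansionOn M.model := ⟨fun _ _ => rfl, fun _ _ => rfl⟩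
    refine model_pairTheory_iff.2 ⟨M.model.is_model, ?_⟩
    exact exists_substructure_model H2 (reductModel h_red M.model) (S := M.S)
      (by rw [← acl_reductModel h_red]; exact M.closed) M.infinite
  Theory.ModelType.of _ M.model

/-- The pair given by a model of `pairTheory`. -/
def Pair.ofModel (h_red : IsReduct h T₀ T) (H2 : IsModelComplete.{u, v, w} T₀)
    (M : Theory.ModelType.{u, v, max u v w} (pairTheory h T₀ T)) : Pair.{u, v, w} h T :=
  letI := h.reduct M
  haveI : ((incl L).comp h).IsExpansionOn M := ⟨fun _ _ => rfl, fun _ _ => rfl⟩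
  haveI : (incl L).IsExpansionOn M := ⟨fun _ _ => rfl, fun _ _ => rfl⟩
  haveI hM : (M : Type _) ⊨ T ∧ ∃ P : L₀.Substructure M, (P : Set M) = predSet L M ∧
      Nonempty P ∧ P ⊨ T₀ := model_pairTheory_iff.1 M.is_model
  haveI := hM.1
  haveI key : acl h (predSet L M) ⊆ predSet L M ∧ ((predSet L M).Infinite ∨ Finite M) := by
    obtain ⟨P, hP, hne, hPT⟩ := hM.2
    let f : P ↪ₑ[L₀] M := elementaryOfModelComplete H2 (M := Theory.ModelType.of T₀ P)
      (N := reductModel h_red (Theory.ModelType.of T M)) P.subtype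
    constructor
    · have := acl_image_elementary (LHom.id L₀) f Set.univ
      rw [acl_eq_acl_id, ← hP, show (P : Set M) = f '' Set.univ by
        rw [Set.image_univ]; exact Subtype.range_coe.symm, this]
      exact Set.image_mono (Set.subset_univ _)
    · by_cases hfin : (predSet L M).Infinite
      · exact Or.inl hfin
      · rw [Set.not_infinite, ← hP] at hfin
        have : Finite P := hfin
        exact Or.inr (finite_of_elementary f)
  ⟨Theory.ModelType.of T M, predSet L M, key.1, key.2⟩

end Pairs

/-! ### Solving the generic axioms over a pair -/

section Compactness

variable {L : FirstOrder.Language.{u, v}}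

/-- Compactness for types: a set of formulas which is finitely satisfiable in models of `T` is
realised in a model of `T`. -/
theorem exists_realize_of_finitely_satisfiable {T : L.Theory} {α : Type (max u v w)}
    (Γ : Set (L.Formula α))
    (hΓ : ∀ Δ : Finset (L.Formula α), (Δ : Set (L.Formula α)) ⊆ Γ →
      ∃ (N : Theory.ModelType.{u, v, max u v w} T) (v : α → N), ∀ γ ∈ Δ, γ.Realize v) :
    ∃ (N : Theory.ModelType.{u, v, max u v w} T) (v : α → N), ∀ γ ∈ Γ, γ.Realize v := by
  classical
  have hsat : Theory.IsSatisfiable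
      ((L.lhomWithConstants α).onTheory T ∪ Formula.equivSentence '' Γ) := by
    rw [Theory.isSatisfiable_iff_isFinitelySatisfiable]
    intro Δ hΔ
    obtain ⟨N, v, hv⟩ := hΓ ((Δ.image Formula.equivSentence.symm).filter (· ∈ Γ))
      (fun γ hγ => (Finset.mem_filter.1 hγ).2)
    let := constantsOn.structure v
    have hmodel : (N : Type _) ⊨ ((Δ : Set (L[[α]].Sentence)) : L[[α]].Theory) := by
      refine (Theory.model_iff _).2 fun σ hσ => ?_
      rcases hΔ hσ with hT | ⟨γ, hγ, rfl⟩
      · have : (N : Type _) ⊨ (L.lhomWithConstants α).onTheory T :=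
          (LHom.onTheory_model _ _).2 N.is_model
        exact this.realize_of_mem _ hT
      · refine (Formula.realize_equivSentence_symm N (Formula.equivSentence γ) v).1 ?_
        rw [Equiv.symm_apply_apply]
        refine hv γ (Finset.mem_filter.2 ⟨Finset.mem_image.2 ⟨_, hσ, ?_⟩, hγ⟩)
        rw [Equiv.symm_apply_apply]
    exact Theory.Model.isSatisfiable N
  obtain ⟨N⟩ := hsat
  let := (L.lhomWithConstants α).reduct N
  have hN := Theory.model_union_iff.1 N.is_model
  have : (N : Type _) ⊨ T := (LHom.onTheory_model (L.lhomWithConstants α) T).1 hN.1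
  refine ⟨Theory.ModelType.of T N, fun a => (L.con a : N), fun γ hγ => ?_⟩
  exact (Formula.realize_equivSentence N γ).1 (hN.2.realize_of_mem _ ⟨γ, hγ, rfl⟩)

/-- A map which satisfies all formulas true in `M` is an elementary embedding. -/
def elementaryOfRealize {M N : Type*} [L.Structure M] [L.Structure N] (g : M → N)
    (H : ∀ γ : L.Formula M, γ.Realize id → γ.Realize g) : M ↪ₑ[L] N where
  toFun := g
  map_formula' n φ x := by
    constructor
    · intro hg
      by_contra hx
      have := H (φ.relabel x).not (by simpa using hx)
      simp only [Formula.realize_not, Formula.realize_relabel] at this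
      exact this hg
    · intro hx
      have := H (φ.relabel x) (by simpa using hx)
      simpa only [Formula.realize_relabel] using this

end Compactness

section Extension

variable {L₀ : FirstOrder.Language.{u, v}} {L : FirstOrder.Language.{u, v}} {h : L₀ →ᴸ L}
  {T₀ : L₀.Theory} {T : L.Theory}
  {θ : ∀ m n : ℕ, L.Formula (Fin m ⊕ Fin n) → L.Formula (Fin m)}

theorem indepOn_univ_iff {M : Type*} [L.Structure M] {ι : Type*} {a : ι → M} {C : Set M} :
    IndepOn (acl h) a Set.univ C ↔ IndependentOver h a C := by
  have : ∀ i : ι, Set.univ \ {i} = {j | j ≠ i} := fun i => by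
    ext j
    simp
  simp only [IndepOn, IndependentOver, this, Set.mem_univ, true_imp_iff]

/-- An instance over `M` of the generic axioms: a formula `φ(b, x)` with parameters `b` in `M`
satisfying `θ`, and a set of coordinates of `x` that are to be placed in the predicate. -/
structure Task (θ : ∀ m n : ℕ, L.Formula (Fin m ⊕ Fin n) → L.Formula (Fin m)) (M : Type*)
    [L.Structure M] where
  /-- the number of parameters -/
  m : ℕ
  /-- the number of variables -/
  n : ℕ
  /-- the formula to be realised -/
  φ : L.Formula (Fin m ⊕ Fin n)
  /-- the parameters -/
  b : Fin m → M
  /-- the coordinates of the solution that are to lie in the predicate -/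
  I : Set (Fin n)
  realize_theta : (θ m n φ).Realize b

/-- The family `a` consists of solutions, in the elementary extension `g`, of all tasks in `P`,
and all these solutions together are independent over the small model. -/
def IsSolution (h : L₀ →ᴸ L) {M N : Type*} [L.Structure M] [L.Structure N] (P : Set (Task θ M))
    (g : M ↪ₑ[L] N) (a : (Σ p : Task θ M, Fin p.n) → N) : Prop :=
  (∀ p ∈ P, p.φ.Realize (Sum.elim (g ∘ p.b) fun i => a ⟨p, i⟩)) ∧
    IndepOn (acl h) a {x | x.1 ∈ P} (Set.range g)

/-- Finitely many tasks are solved one after the other. -/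
theorem exists_isSolution_finset (h_red : IsReduct h T₀ T) (H3 : IsPregeometric.{u, v, w} T₀)
    (H4 : ∀ (m n : ℕ) (φ : L.Formula (Fin m ⊕ Fin n)),
      DefinesGenericity.{u, v, w} h T φ (θ m n φ))
    (M : Theory.ModelType.{u, v, max u v w} T) (P : Finset (Task θ M)) :
    ∃ (N : Theory.ModelType.{u, v, max u v w} T) (g : M ↪ₑ[L] N)
      (a : (Σ p : Task θ M, Fin p.n) → N), IsSolution h (P : Set (Task θ M)) g a := by
  classical
  induction P using Finset.induction_on with
  | empty =>
    obtain ⟨x⟩ := M.nonempty'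
    refine ⟨M, ElementaryEmbedding.refl L M, fun _ => x, ?_, ?_⟩
    · intro p hp
      exact absurd hp (Finset.notMem_empty p)
    · intro y hy
      exact absurd hy (Finset.notMem_empty y.1)
  | @insert p P hp ih =>
    obtain ⟨N, g, a, hφ, hind⟩ := ih
    obtain ⟨N', f, a', hφ', hind'⟩ := (H4 p.m p.n p.φ N (g ∘ p.b)).1
      ((g.map_formula _ _).2 p.realize_theta)
    have hcl := isPregeometry_acl h_red H3 N'
    let a₁ : (Σ p : Task θ M, Fin p.n) → N' := fun x =>
      if hx : x.1 = p then a' (hx ▸ x.2) else f (a x)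
    have ha₁ : ∀ i, a₁ ⟨p, i⟩ = a' i := fun i => by simp [a₁]
    have ha₂ : ∀ x, x.1 ≠ p → a₁ x = f (a x) := fun x hx => by simp [a₁, hx]
    refine ⟨N', f.comp g, a₁, ?_, ?_⟩
    · intro q hq
      by_cases hqp : q = p
      · subst hqp
        simp only [ha₁]
        exact hφ'
      · have hqP : q ∈ P := by simpa [hqp] using hq
        have := (f.map_formula _ _).2 (hφ q hqP)
        refine (iff_of_eq (congrArg _ (funext fun i => ?_))).1 this
        rcases i with i | i
        · rfl
        · exact (ha₂ ⟨q, i⟩ hqp).symm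
    · rintro ⟨q, i⟩ hq hmem
      by_cases hqp : q = p
      · subst hqp
        rw [ha₁] at hmem
        refine hind' i (hcl.mono (Set.union_subset ?_ ?_) hmem)
        · rintro _ ⟨x, rfl⟩
          exact Or.inl ⟨g x, rfl⟩
        · rintro _ ⟨⟨r, j⟩, ⟨-, hne⟩, rfl⟩
          by_cases hr : r = q
          · subst hr
            rw [ha₁]
            exact Or.inr ⟨j, fun hij => hne (by rw [hij]; rfl), rfl⟩
          · rw [ha₂ _ hr]
            exact Or.inl ⟨_, rfl⟩
      · have hqP : q ∈ P := by simpa [hqp] using hq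
        rw [ha₂ _ hqp] at hmem
        refine hind ⟨q, i⟩ hqP ((mem_acl_elementary h f).1 ?_)
        refine hcl.mem_of_mem_union_image (indepOn_univ_iff.2 hind') ?_
          (hcl.subset _ ⟨_, rfl⟩) (hcl.mono (Set.union_subset ?_ ?_) hmem)
        · exact (Set.image_subset_range _ _).trans (hcl.subset _)
        · rintro _ ⟨x, rfl⟩
          exact Or.inl ⟨g x, Or.inl ⟨x, rfl⟩, rfl⟩
        · rintro _ ⟨⟨r, j⟩, ⟨hr, hne⟩, rfl⟩
          by_cases hrp : r = p
          · subst hrp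
            rw [ha₁]
            exact Or.inr ⟨j, trivial, rfl⟩
          · have hrP : r ∈ P := by simpa [hrp] using hr
            rw [ha₂ _ hrp]
            exact Or.inl ⟨_, Or.inr ⟨⟨r, j⟩, ⟨hrP, hne⟩, rfl⟩, rfl⟩

/-- All tasks over a model are solved simultaneously, by compactness. -/
theorem exists_isSolution (h_red : IsReduct h T₀ T) (H3 : IsPregeometric.{u, v, w} T₀)
    (H4 : ∀ (m n : ℕ) (φ : L.Formula (Fin m ⊕ Fin n)),
      DefinesGenericity.{u, v, w} h T φ (θ m n φ))
    (M : Theory.ModelType.{u, v, max u v w} T) :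
    ∃ (N : Theory.ModelType.{u, v, max u v w} T) (g : M ↪ₑ[L] N)
      (a : (Σ p : Task θ M, Fin p.n) → N), IsSolution h Set.univ g a := by
  classical
  -- The type to be realised consists of everything that holds for the solutions of some finite
  -- set of tasks.
  let Γ : Set (L.Formula (M ⊕ Σ p : Task θ M, Fin p.n)) := {γ | ∃ P : Finset (Task θ M),
    ∀ (N : Theory.ModelType.{u, v, max u v w} T) (g : M ↪ₑ[L] N)
      (a : (Σ p : Task θ M, Fin p.n) → N), IsSolution h (P : Set (Task θ M)) g a →
      γ.Realize (Sum.elim g a)}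
  obtain ⟨N, v, hv⟩ := exists_realize_of_finitely_satisfiable.{u, v, w} (T := T) Γ (by
    intro Δ hΔ
    have : ∀ γ : Δ, ∃ P : Finset (Task θ M),
        ∀ (N : Theory.ModelType.{u, v, max u v w} T) (g : M ↪ₑ[L] N)
        (a : (Σ p : Task θ M, Fin p.n) → N), IsSolution h (P : Set (Task θ M)) g a →
        γ.1.Realize (Sum.elim g a) := fun γ => hΔ γ.2
    choose P hP using this
    obtain ⟨N, g, a, hφ, hind⟩ := exists_isSolution_finset h_red H3 H4 M
      (Finset.univ.biUnion P)
    refine ⟨N, Sum.elim g a, fun γ hγ => hP ⟨γ, hγ⟩ N g a ⟨fun p hp => hφ p ?_, ?_⟩⟩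
    · exact Finset.mem_biUnion.2 ⟨⟨γ, hγ⟩, Finset.mem_univ _, hp⟩
    · refine (isPregeometry_acl h_red H3 N).indepOn_mono hind ?_ (subset_acl h _)
      intro x hx
      exact Finset.mem_biUnion.2 ⟨⟨γ, hγ⟩, Finset.mem_univ _, hx⟩)
  let g : M ↪ₑ[L] N := elementaryOfRealize (fun x => v (Sum.inl x)) fun γ hγ => by
    have := hv (γ.relabel Sum.inl) ⟨∅, fun N g a _ => by
      rw [Formula.realize_relabel, Sum.elim_comp_inl]
      exact (g.map_formula γ id).2 hγ⟩
    rwa [Formula.realize_relabel] at this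
  refine ⟨N, g, fun x => v (Sum.inr x), ?_, ?_⟩
  · intro p _
    have := hv (p.φ.relabel (Sum.map p.b fun i => ⟨p, i⟩)) ⟨{p}, fun N g a hs => by
      rw [Formula.realize_relabel, Sum.elim_comp_map]
      exact hs.1 p (by simp)⟩
    rw [Formula.realize_relabel] at this
    refine (iff_of_eq (congrArg _ (funext fun i => ?_))).1 this
    rcases i with i | i <;> rfl
  · intro x _ hx
    obtain ⟨F, hF, hfin, hx⟩ := (isPregeometry_acl h_red H3 N).finitary_right hx
    obtain ⟨J, hJ, hJfin, hx⟩ := Set.exists_subset_image_finite_and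
      (p := fun F => v (Sum.inr x) ∈ acl h (Set.range g ∪ F)) |>.1 ⟨F, hF, hfin, hx⟩
    let K : Set (M ⊕ Σ p : Task θ M, Fin p.n) := Set.range Sum.inl ∪ Sum.inr '' J
    have hK : Set.range g ∪ (fun x => v (Sum.inr x)) '' J = v '' K := by
      rw [Set.image_union, ← Set.range_comp, Set.image_image]
      rfl
    rw [hK, mem_acl_image] at hx
    obtain ⟨k, ψ, hψ⟩ := hx
    have := hv ((h.onFormula (bdd k ψ)).relabel (Sum.elim Subtype.val fun _ =>
        Sum.inr x)).not ⟨insert x.1 (hJfin.toFinset.image Sigma.fst), fun N' g' a' hs => by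
      rw [Formula.realize_not, Formula.realize_relabel]
      intro hr
      have hmem : a' x ∈ acl h (Sum.elim g' a' '' K) := by
        rw [mem_acl_image]
        refine ⟨k, ψ, (iff_of_eq (congrArg _ (funext fun i => ?_))).1 hr⟩
        rcases i with i | i <;> rfl
      refine hs.2 x (Finset.mem_insert_self _ _) (acl_mono h ?_ hmem)
      rintro _ ⟨_, ⟨y, rfl⟩ | ⟨y, hy, rfl⟩, rfl⟩
      · exact Or.inl ⟨y, rfl⟩
      · refine Or.inr ⟨y, ⟨?_, (hJ hy).2⟩, rfl⟩
        exact Finset.mem_insert_of_mem (Finset.mem_image.2 ⟨y, hJfin.mem_toFinset.2 hy, rfl⟩)⟩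
    rw [Formula.realize_not, Formula.realize_relabel] at this
    refine this ((iff_of_eq (congrArg _ (funext fun i => ?_))).1 hψ)
    rcases i with i | i <;> rfl

/-- An elementary embedding of pairs: it is elementary for `L`, respects the predicate, and the
predicate of the large pair is free from the small model over the predicate of the small pair. -/
structure StrongEmbedding (M N : Pair.{u, v, w} h T) where
  /-- the underlying elementary embedding -/
  toElem : M.model ↪ₑ[L] N.model
  mem_S : ∀ x, toElem x ∈ N.S ↔ x ∈ M.S
  free : ∀ (D : Set M.model) (c : M.model), toElem c ∈ acl h (N.S ∪ toElem '' D) →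
    c ∈ acl h (M.S ∪ D)

theorem isFree_iff {M N : Type*} [L.Structure M] [L.Structure N] (f : M ↪ₑ[L] N) {S : Set M}
    {S' : Set N} : IsFree (acl h) S' (f '' S) (Set.range f) ↔
      ∀ (D : Set M) (c : M), f c ∈ acl h (S' ∪ f '' D) → c ∈ acl h (S ∪ D) := by
  constructor
  · intro H D c hc
    have := H (f '' D) (Set.image_subset_range _ _) (f c) ⟨c, rfl⟩ hc
    rwa [← Set.image_union, mem_acl_elementary] at this
  · rintro H D hD _ ⟨c, rfl⟩ hc
    obtain ⟨D, rfl⟩ := Set.subset_range_iff_exists_image_eq.1 hD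
    rw [← Set.image_union, mem_acl_elementary]
    exact H D c hc

/-- Every pair has a strong extension which solves all instances of the generic axioms over it. -/
theorem exists_strongEmbedding_solving (h_red : IsReduct h T₀ T)
    (H3 : IsPregeometric.{u, v, w} T₀)
    (H4 : ∀ (m n : ℕ) (φ : L.Formula (Fin m ⊕ Fin n)),
      DefinesGenericity.{u, v, w} h T φ (θ m n φ)) (M : Pair.{u, v, w} h T) :
    ∃ (N : Pair.{u, v, w} h T) (f : StrongEmbedding M N),
      ∀ (m n : ℕ) (φ : L.Formula (Fin m ⊕ Fin n)) (I : Set (Fin n)) (b : Fin m → M.model),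
        (θ m n φ).Realize b → ∃ a : Fin n → N.model, φ.Realize (Sum.elim (f.toElem ∘ b) a) ∧
          (∀ i ∈ I, a i ∈ N.S) ∧ ∀ τ : L₀.Formula ((Fin m ⊕ Fin n) ⊕ Unit),
          IsStrictFormula.{u, v, w} T₀ I τ → ∀ t, (h.onFormula τ).Realize
            (Sum.elim (Sum.elim (f.toElem ∘ b) a) fun _ => t) → t ∉ N.S := by
  obtain ⟨N, g, a, hφ, hind⟩ := exists_isSolution h_red H3 H4 M.model
  have hcl := isPregeometry_acl h_red H3 N
  let J : Set (Σ p : Task θ M.model, Fin p.n) := {x | x.2 ∈ x.1.I}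
  have hgS : g '' M.S ⊆ Set.range g := Set.image_subset_range _ _
  let N' : Pair.{u, v, w} h T := ⟨N, acl h (g '' M.S ∪ a '' J), hcl.idem, by
    rcases M.infinite with hinf | hfin
    · exact Or.inl ((hinf.image g.injective.injOn).mono
        (Set.subset_union_left.trans (hcl.subset _)))
    · exact Or.inr (finite_of_elementary g)⟩
  have hfree : IsFree (acl h) N'.S (g '' M.S) (Set.range g) := by
    intro D hD c hc hmem
    refine hcl.mem_of_mem_union_image (J := J)
      (hcl.indepOn_mono hind (fun _ _ => trivial) (hcl.subset _))
      ((Set.union_subset hgS hD).trans (hcl.subset _)) (hcl.subset _ hc) ?_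
    refine hcl.cl_union_subset (hcl.mono ?_) ?_ hmem
    · exact Set.union_subset_union_left _ Set.subset_union_left
    · exact Set.Subset.trans (Set.subset_union_right.trans Set.subset_union_left) (hcl.subset _)
  let f : StrongEmbedding M N' := ⟨g, fun x => by
    constructor
    · intro hx
      have := hfree ∅ (Set.empty_subset _) (g x) ⟨x, rfl⟩ (hcl.subset _ (Or.inl hx))
      rw [Set.union_empty, mem_acl_elementary] at this
      exact M.closed this
    · intro hx
      exact hcl.subset _ (Or.inl ⟨x, hx, rfl⟩), (isFree_iff g).1 hfree⟩
  refine ⟨N', f, ?_⟩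
  intro m n φ I b hb
  let p : Task θ M.model := ⟨m, n, φ, b, I, hb⟩
  refine ⟨fun i => a ⟨p, i⟩, hφ p trivial, fun i hi => ?_, ?_⟩
  · exact hcl.subset _ (Or.inr ⟨⟨p, i⟩, hi, rfl⟩)
  · intro τ hτ t ht htS
    have hb' : Set.range (g ∘ b) ⊆ Set.range g := Set.range_comp_subset_range _ _
    obtain ⟨h1, h2⟩ := hτ.spec h_red N (g ∘ b) (fun i => a ⟨p, i⟩) (by
      rintro ⟨i, hi⟩ hmem
      refine hind ⟨p, i⟩ trivial (hcl.mono ?_ hmem)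
      refine Set.union_subset (Set.union_subset (hb'.trans Set.subset_union_left) ?_) ?_
      · rintro _ ⟨j, hj, rfl⟩
        refine Or.inr ⟨⟨p, j⟩, ⟨trivial, ?_⟩, rfl⟩
        rintro ⟨⟩
        exact hi hj
      · rintro _ ⟨j, hj, rfl⟩
        refine Or.inr ⟨⟨p, j⟩, ⟨trivial, ?_⟩, rfl⟩
        intro hji
        obtain ⟨-, hji⟩ := Sigma.mk.inj_iff.1 hji
        exact hj (Subtype.ext (eq_of_heq hji))) ht
    refine h2 ?_
    have hrange : Set.range (fun i => a ⟨p, i⟩) = a '' {x | x.1 = p} := by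
      ext y
      constructor
      · rintro ⟨i, rfl⟩
        exact ⟨⟨p, i⟩, rfl, rfl⟩
      · rintro ⟨⟨_, i⟩, rfl, rfl⟩
        exact ⟨i, rfl⟩
    rw [hrange] at h1
    -- A solution in the predicate would be algebraic over the coordinates common to `J` and the
    -- tuple of this task, against strictness.
    have h3 := hcl.mem_inter_of_indepOn hind (K₁ := J) (K₂ := {x | x.1 = p})
      (fun _ _ => trivial) (fun _ _ => trivial) (hb'.trans (hcl.subset _))
      (hcl.mono (Set.union_subset_union_left _ hgS) htS) h1
    refine hcl.mono (Set.union_subset_union_right _ ?_) h3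
    rintro _ ⟨⟨q, i⟩, ⟨hq, hi⟩, rfl⟩
    obtain rfl : q = p := hq
    exact ⟨i, hi, rfl⟩

end Extension

/-! ### Unions of chains of pairs -/

section ElementaryChain

variable {L : FirstOrder.Language.{u, v}} {G : ℕ → Type w} [∀ i, L.Structure (G i)]
  (f : ∀ i j, i ≤ j → G i ↪[L] G j) [DirectedSystem G fun i j h => f i j h]

/-- The Tarski–Vaught theorem on elementary chains. -/
theorem realize_directLimit_of (hf : ∀ i j hij, ∃ g : G i ↪ₑ[L] G j, ∀ x, g x = f i j hij x)
    {α : Type*} {n : ℕ} (φ : L.BoundedFormula α n) (i : ℕ) (v : α → G i) (xs : Fin n → G i) :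
    φ.Realize (Language.DirectLimit.of L ℕ G f i ∘ v) (Language.DirectLimit.of L ℕ G f i ∘ xs) ↔
      φ.Realize v xs := by
  induction φ generalizing i with
  | falsum => rfl
  | equal t₁ t₂ =>
    exact (BoundedFormula.IsAtomic.equal t₁ t₂).isQF.realize_embedding
      (Language.DirectLimit.of L ℕ G f i)
  | rel R ts =>
    exact (BoundedFormula.IsAtomic.rel R ts).isQF.realize_embedding
      (Language.DirectLimit.of L ℕ G f i)
  | imp _ _ ih₁ ih₂ => exact imp_congr (ih₁ i v xs) (ih₂ i v xs)
  | @all n φ ih =>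
    constructor
    · intro H y
      have := H (Language.DirectLimit.of L ℕ G f i y)
      rwa [← Fin.comp_snoc, ih] at this
    · intro H z
      obtain ⟨j, y, rfl⟩ := Language.DirectLimit.exists_of z
      obtain ⟨g, hg⟩ := hf i (max i j) (le_max_left i j)
      have h1 : ∀ x, Language.DirectLimit.of L ℕ G f i x =
          Language.DirectLimit.of L ℕ G f (max i j) (g x) :=
        fun x => by rw [hg]; exact Language.DirectLimit.of_f.symm
      have h2 : Language.DirectLimit.of L ℕ G f j y =
          Language.DirectLimit.of L ℕ G f (max i j) (f j (max i j) (le_max_right i j) y) :=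
        Language.DirectLimit.of_f.symm
      have h3 := (g.map_boundedFormula φ.all v xs).2 H (f j (max i j) (le_max_right i j) y)
      rw [← ih, Fin.comp_snoc, ← h2] at h3
      rw [show Language.DirectLimit.of L ℕ G f i ∘ v =
        Language.DirectLimit.of L ℕ G f (max i j) ∘ (g ∘ v) from funext fun a => h1 _,
        show Language.DirectLimit.of L ℕ G f i ∘ xs =
        Language.DirectLimit.of L ℕ G f (max i j) ∘ (g ∘ xs) from funext fun a => h1 _]
      exact h3

/-- The embedding of a member of an elementary chain in the union of the chain. -/
noncomputable def elementaryOf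
    (hf : ∀ i j hij, ∃ g : G i ↪ₑ[L] G j, ∀ x, g x = f i j hij x) (i : ℕ) :
    G i ↪ₑ[L] Language.DirectLimit G f where
  toFun := Language.DirectLimit.of L ℕ G f i
  map_formula' n φ x := by
    rw [Formula.Realize, Formula.Realize, ← realize_directLimit_of f hf φ i x default]
    exact iff_of_eq (congrArg _ (Subsingleton.elim _ _))

end ElementaryChain

section Chain

variable {L₀ : FirstOrder.Language.{u, v}} {L : FirstOrder.Language.{u, v}} {h : L₀ →ᴸ L}
  {T₀ : L₀.Theory} {T : L.Theory}
  {θ : ∀ m n : ℕ, L.Formula (Fin m ⊕ Fin n) → L.Formula (Fin m)}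

/-- The identity embedding of a pair. -/
def StrongEmbedding.refl (M : Pair.{u, v, w} h T) : StrongEmbedding M M where
  toElem := ElementaryEmbedding.refl L M.model
  mem_S _ := Iff.rfl
  free D c hc := by
    rwa [show ElementaryEmbedding.refl L M.model '' D = D from Set.image_id D] at hc

/-- The composition of embeddings of pairs. -/
def StrongEmbedding.comp {M N P : Pair.{u, v, w} h T} (g : StrongEmbedding N P)
    (f : StrongEmbedding M N) : StrongEmbedding M P where
  toElem := g.toElem.comp f.toElem
  mem_S x := (g.mem_S _).trans (f.mem_S x)
  free D c hc := by
    refine f.free D c (g.free _ _ ?_)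
    rw [Set.image_image]
    exact hc

theorem IsAlgebraicFormula.mem_acl (h_red : IsReduct h T₀ T) {m n : ℕ}
    {τ : L₀.Formula ((Fin m ⊕ Fin n) ⊕ Unit)} (hτ : IsAlgebraicFormula.{u, v, w} T₀ τ)
    (M : Theory.ModelType.{u, v, max u v w} T) {c : Fin m ⊕ Fin n → M} {t : M}
    (ht : (h.onFormula τ).Realize (Sum.elim c fun _ => t)) : t ∈ acl h (Set.range c) := by
  obtain ⟨k, hk⟩ := hτ
  let := h.reduct M
  rw [LHom.realize_onFormula] at ht
  obtain ⟨l, hl⟩ := exists_realize_bdd (Set.finite_of_encard_le_coe (hk (reductModel h_red M) c))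
  refine (mem_acl_range h).2 ⟨l, τ, ?_⟩
  rw [LHom.realize_onFormula]
  exact hl t ht

/-- The union of a chain of strong extensions of pairs is a strong extension of all its
members. -/
theorem exists_union_of_chain (h_red : IsReduct h T₀ T) (H3 : IsPregeometric.{u, v, w} T₀)
    (P : ℕ → Pair.{u, v, w} h T) (e : ∀ n, StrongEmbedding (P n) (P (n + 1))) :
    ∃ (N : Pair.{u, v, w} h T) (o : ∀ i, StrongEmbedding (P i) N),
      (∀ i x, (o (i + 1)).toElem ((e i).toElem x) = (o i).toElem x) ∧
      ∀ (m : ℕ) (x : Fin m → N.model), ∃ (i : ℕ) (y : Fin m → (P i).model),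
        x = (o i).toElem ∘ y := by
  let G : ℕ → Type (max u v w) := fun n => (P n).model
  let F : ∀ i j, i ≤ j → G i ↪[L] G j :=
    DirectedSystem.natLERec fun n => (e n).toElem.toEmbedding
  have hF₀ : ∀ i j (hij : i ≤ j) x, F i (j + 1) (hij.trans j.le_succ) x =
      (e j).toElem (F i j hij x) := by
    intro i j hij x
    simp only [F, DirectedSystem.coe_natLERec]
    exact Nat.leRecOn_succ hij x
  have hF₁ : ∀ i x, F i i le_rfl x = x := by
    intro i x
    simp only [F, DirectedSystem.coe_natLERec]
    exact Nat.leRecOn_self x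
  have hs : ∀ i j (hij : i ≤ j), ∃ s : StrongEmbedding (P i) (P j),
      ∀ x, s.toElem x = F i j hij x := by
    intro i j hij
    induction j, hij using Nat.le_induction with
    | base => exact ⟨StrongEmbedding.refl _, fun x => (hF₁ i x).symm⟩
    | succ j hij ih =>
      obtain ⟨s, hs⟩ := ih
      refine ⟨(e j).comp s, fun x => ?_⟩
      rw [hF₀ i j hij, ← hs]
      rfl
  have : DirectedSystem G fun i j hij => F i j hij := DirectedSystem.natLERec.directedSystem _
  have hel : ∀ i j hij, ∃ g : G i ↪ₑ[L] G j, ∀ x, g x = F i j hij x := fun i j hij =>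
    let ⟨s, hs⟩ := hs i j hij
    ⟨s.toElem, hs⟩
  let o : ∀ i, G i ↪ₑ[L] Language.DirectLimit G F := elementaryOf F hel
  have ho : ∀ i j (hij : i ≤ j) x, o j (F i j hij x) = o i x := fun i j hij x =>
    Language.DirectLimit.of_f (L := L) (ι := ℕ) (G := G) (f := F) (hij := hij) (x := x)
  let S : Set (Language.DirectLimit G F) := {z | ∃ i, ∃ x ∈ (P i).S, o i x = z}
  have hS : ∀ i x, o i x ∈ S ↔ x ∈ (P i).S := by
    intro i x
    refine ⟨?_, fun hx => ⟨i, x, hx, rfl⟩⟩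
    rintro ⟨j, y, hy, hyx⟩
    obtain ⟨s, hs₁⟩ := hs i (max i j) (le_max_left i j)
    obtain ⟨s', hs₂⟩ := hs j (max i j) (le_max_right i j)
    rw [← ho i _ (le_max_left i j), ← ho j _ (le_max_right i j), ← hs₁, ← hs₂] at hyx
    rw [← s.mem_S, ← (o _).injective hyx, s'.mem_S]
    exact hy
  have hfinS : ∀ A : Set (Language.DirectLimit G F), A.Finite → A ⊆ S →
      ∃ i, ∀ j, i ≤ j → A ⊆ o j '' (P j).S := by
    intro A hA hAS
    have := hA.to_subtype
    obtain ⟨i, y, hy⟩ := Language.DirectLimit.exists_quotient_mk'_sigma_mk'_eq G F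
      (fun a : A => (a : Language.DirectLimit G F))
    refine ⟨i, fun j hij a ha => ⟨F i j hij (y ⟨a, ha⟩), ?_, ?_⟩⟩
    · rw [← hS, ho]
      have := hAS ha
      rwa [show a = o i (y ⟨a, ha⟩) from congrFun hy ⟨a, ha⟩] at this
    · exact (ho _ _ _ _).trans (congrFun hy ⟨a, ha⟩).symm
  have : Nonempty (Language.DirectLimit G F) := (P 0).model.nonempty'.map (o 0)
  have : Language.DirectLimit G F ⊨ T := ((o 0).theory_model_iff T).1 (P 0).model.is_model
  have hcl : IsPregeometry (acl h : Set (Language.DirectLimit G F) → _) :=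
    isPregeometry_acl h_red H3 (Theory.ModelType.of T (Language.DirectLimit G F))
  have hclosed : acl h S ⊆ S := by
    intro c hc
    obtain ⟨A, hAS, hA, hc⟩ := hcl.finitary hc
    obtain ⟨i, hi⟩ := hfinS A hA hAS
    have := hcl.mono (hi i le_rfl) hc
    rw [acl_image_elementary h (o i)] at this
    obtain ⟨x, hx, rfl⟩ := this
    exact (hS i x).2 ((P i).closed hx)
  have hinfinite : S.Infinite ∨ Finite (Language.DirectLimit G F) := by
    rcases (P 0).infinite with hinf | hfin
    · refine Or.inl ((hinf.image (o 0).injective.injOn).mono ?_)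
      rintro _ ⟨x, hx, rfl⟩
      exact (hS 0 x).2 hx
    · exact Or.inr (finite_of_elementary (M := (P 0).model) (o 0))
  have hfree : ∀ i (D : Set (G i)) (c : G i), o i c ∈ acl h (S ∪ o i '' D) →
      c ∈ acl h ((P i).S ∪ D) := by
    intro i D c hc
    rw [Set.union_comm] at hc
    obtain ⟨A, hAS, hA, hc⟩ := hcl.finitary_right hc
    obtain ⟨j, hj⟩ := hfinS A hA hAS
    obtain ⟨s, hs⟩ := hs i (max i j) (le_max_left i j)
    have ho' : ∀ x, o i x = o (max i j) (s.toElem x) := fun x => by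
      rw [hs]
      exact (ho i _ (le_max_left i j) x).symm
    refine s.free D c ((mem_acl_elementary h (o (max i j))).1 ?_)
    rw [← ho']
    refine hcl.mono (Set.union_subset ?_ ?_) hc
    · rintro _ ⟨x, hx, rfl⟩
      exact ⟨s.toElem x, Or.inr ⟨x, hx, rfl⟩, (ho' x).symm⟩
    · exact (hj _ (le_max_right i j)).trans (Set.image_mono Set.subset_union_left)
  refine ⟨⟨Theory.ModelType.of T (Language.DirectLimit G F), S, hclosed, hinfinite⟩,
    fun i => ⟨o i, hS i, hfree i⟩, fun i x => ?_, fun m x => ?_⟩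
  · have := ho i (i + 1) i.le_succ x
    rwa [hF₀ i i le_rfl, hF₁] at this
  · exact Language.DirectLimit.exists_quotient_mk'_sigma_mk'_eq G F x

/-- Every pair has a strong extension satisfying the generic axioms: the union of a chain in which
each member solves all instances of the generic axioms over the previous one. -/
theorem exists_strongEmbedding_scheme (h_red : IsReduct h T₀ T)
    (H3 : IsPregeometric.{u, v, w} T₀)
    (H4 : ∀ (m n : ℕ) (φ : L.Formula (Fin m ⊕ Fin n)),
      DefinesGenericity.{u, v, w} h T φ (θ m n φ)) (M : Pair.{u, v, w} h T) :
    ∃ (N : Pair.{u, v, w} h T) (_ : StrongEmbedding M N),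
      SatisfiesScheme.{u, v, w} h T₀ θ N.S := by
  choose next emb hemb using exists_strongEmbedding_solving (T := T) h_red H3 H4
  obtain ⟨N, o, ho, htuple⟩ := exists_union_of_chain h_red H3
    (fun n => Nat.rec M (fun _ => next) n) fun n => emb _
  refine ⟨N, o 0, ?_⟩
  intro m n k I φ τ hτ b hb
  obtain ⟨i, b, rfl⟩ := htuple m b
  obtain ⟨a, hφ, haS, hτS⟩ := hemb _ m n φ I b (((o i).toElem.map_formula _ _).1 hb)
  have hsum : Sum.elim ((o i).toElem ∘ b) ((o (i + 1)).toElem ∘ a) =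
      (o (i + 1)).toElem ∘ Sum.elim ((emb _).toElem ∘ b) a := by
    rw [Sum.comp_elim]
    exact congrArg (Sum.elim · _) (funext fun j => (ho i (b j)).symm)
  refine ⟨(o (i + 1)).toElem ∘ a, ?_, fun j hj => ((o (i + 1)).mem_S (a j)).2 (haS j hj), ?_⟩
  · rw [hsum]
    exact ((o (i + 1)).toElem.map_formula _ _).2 hφ
  · intro l t ht
    rw [hsum] at ht
    have hmem := (hτ l).1.mem_acl h_red N.model ht
    rw [Set.range_comp, acl_image_elementary h (o (i + 1)).toElem] at hmem
    -- The solutions of an algebraic formula do not grow in elementary extensions.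
    obtain ⟨t, -, rfl⟩ := hmem
    intro htS
    refine hτS (τ l) (hτ l).2 t ?_ (((o (i + 1)).mem_S t).1 htS)
    refine ((o (i + 1)).toElem.map_formula _ _).1 ?_
    rw [Sum.comp_elim]
    exact ht

end Chain

/-! ### Formulas deciding membership in the predicate -/

section Certificates

variable {L₀ : FirstOrder.Language.{u, v}} {L : FirstOrder.Language.{u, v}} {h : L₀ →ᴸ L}
  {T₀ : L₀.Theory} {T : L.Theory}

/-- Dependence of one coordinate of a tuple on others is witnessed by a formula, which forces the
same dependence in all tuples satisfying it. -/
theorem exists_dependence_formula {W : Type*} {N : Type*} [L.Structure N] {c : W → N} {x : W}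
    {J : Set W} (hx : c x ∈ acl h (c '' J)) :
    ∃ χ : L₀.Formula W, (h.onFormula χ).Realize c ∧
      ∀ {L' : FirstOrder.Language.{u, v}} (h' : L₀ →ᴸ L') {M : Type w} [L'.Structure M]
        (d : W → M), (h'.onFormula χ).Realize d → d x ∈ acl h' (d '' J) := by
  obtain ⟨k, ψ, hψ⟩ := (mem_acl_image h).1 hx
  refine ⟨(bdd k ψ).relabel (Sum.elim (fun j : J => (j : W)) fun _ => x), ?_, ?_⟩
  · let := h.reduct N
    rw [LHom.realize_onFormula] at hψ ⊢
    rw [Formula.realize_relabel, Sum.comp_elim]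
    exact hψ
  · intro L' h' M _ d hd
    let := h'.reduct M
    rw [LHom.realize_onFormula, Formula.realize_relabel, Sum.comp_elim] at hd
    exact (mem_acl_image h').2 ⟨k, ψ, (LHom.realize_onFormula h' _).2 hd⟩

/-- The formula `χ(b, a, y)` together with the avoidance condition given by `τ` decides whether an
element lies in the predicate: it holds at `y`, and whenever it holds in the small model at `y'`
and a tuple `a'` as provided by the generic axioms, `y'` lies in the predicate if and only if `y`
does. -/
structure IsCertificate (T₀ : L₀.Theory) (h : L₀ →ᴸ L) {M N : Type (max u v w)} [L.Structure M]
    [L.Structure N] (f : M → N) (S : Set M) (S' : Set N) {m n : ℕ} (b : Fin m → M)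
    (I : Set (Fin n)) (a : Fin n → N) (y : N) (χ τ : L₀.Formula ((Fin m ⊕ Fin n) ⊕ Unit)) :
    Prop where
  algebraic : IsAlgebraicFormula.{u, v, w} T₀ τ
  strict : IsStrictFormula.{u, v, w} T₀ I τ
  realize : (h.onFormula χ).Realize (Sum.elim (Sum.elim (f ∘ b) a) fun _ => y)
  decides : ∀ (a' : Fin n → M) (y' : M),
    (h.onFormula χ).Realize (Sum.elim (Sum.elim b a') fun _ => y') → (∀ i ∈ I, a' i ∈ S) →
    (∀ t, (h.onFormula τ).Realize (Sum.elim (Sum.elim b a') fun _ => t) → t ∉ S) →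
    (y' ∈ S ↔ y ∈ S')

theorem isAlgebraicFormula_bot {m n : ℕ} :
    IsAlgebraicFormula.{u, v, w} T₀ (⊥ : L₀.Formula ((Fin m ⊕ Fin n) ⊕ Unit)) :=
  ⟨0, fun M c => by simp⟩

theorem isStrictFormula_bot {m n : ℕ} {I : Set (Fin n)} :
    IsStrictFormula.{u, v, w} T₀ I (⊥ : L₀.Formula ((Fin m ⊕ Fin n) ⊕ Unit)) :=
  fun _ _ _ _ _ ht => ht.elim

variable {M N : Type (max u v w)} [L.Structure M] [L.Structure N] {f : M → N} {S : Set M}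
  {S' : Set N} {m n : ℕ} {b : Fin m → M} {I : Set (Fin n)} {a : Fin n → N} {y : N}

/-- An element of the predicate which is algebraic over the part of the predicate below. -/
theorem exists_certificate_of_mem (hS : acl h S ⊆ S) (hy : y ∈ S')
    (hmem : y ∈ acl h (f '' (Set.range b ∩ S) ∪ a '' I)) :
    ∃ χ τ, IsCertificate.{u, v, w} T₀ h f S S' b I a y χ τ := by
  let J : Set ((Fin m ⊕ Fin n) ⊕ Unit) :=
    Sum.inl '' (Sum.inl '' {l | b l ∈ S} ∪ Sum.inr '' I)
  obtain ⟨χ, hχ, hχ'⟩ := exists_dependence_formula.{u, v, max u v w} (h := h)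
    (c := Sum.elim (Sum.elim (f ∘ b) a) fun _ : Unit => y) (x := Sum.inr ()) (J := J) (by
      refine acl_mono h ?_ hmem
      rintro _ (⟨_, ⟨⟨l, rfl⟩, hl⟩, rfl⟩ | ⟨i, hi, rfl⟩)
      · exact ⟨_, ⟨_, Or.inl ⟨l, hl, rfl⟩, rfl⟩, rfl⟩
      · exact ⟨_, ⟨_, Or.inr ⟨i, hi, rfl⟩, rfl⟩, rfl⟩)
  refine ⟨χ, ⊥, isAlgebraicFormula_bot, isStrictFormula_bot, hχ, fun a' y' hr ha' _ => ?_⟩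
  refine iff_of_true (hS (acl_mono h ?_ (hχ' h _ hr))) hy
  rintro _ ⟨_, ⟨_, ⟨l, hl, rfl⟩ | ⟨i, hi, rfl⟩, rfl⟩, rfl⟩
  · exact hl
  · exact ha' i hi

/-- An element outside the predicate which is interdependent, over the predicate, with an element
`e` of the small model that is not algebraic over the predicate. -/
theorem exists_certificate_of_interdependent {Q : Set M} {e : M} (hy : y ∉ S')
    (he : e ∈ Set.range b) (heQ : e ∉ acl h (S ∪ Q))
    (hmem : f e ∈ acl h (insert y (f '' (Set.range b ∩ (S ∪ Q)) ∪ a '' I))) :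
    ∃ χ τ, IsCertificate.{u, v, w} T₀ h f S S' b I a y χ τ := by
  obtain ⟨l₀, rfl⟩ := he
  let J : Set ((Fin m ⊕ Fin n) ⊕ Unit) := insert (Sum.inr ())
    (Sum.inl '' (Sum.inl '' {l | b l ∈ S ∪ Q} ∪ Sum.inr '' I))
  obtain ⟨χ, hχ, hχ'⟩ := exists_dependence_formula.{u, v, max u v w} (h := h)
    (c := Sum.elim (Sum.elim (f ∘ b) a) fun _ : Unit => y) (x := Sum.inl (Sum.inl l₀))
    (J := J) (by
      refine acl_mono h ?_ hmem
      rintro _ (rfl | ⟨_, ⟨⟨l, rfl⟩, hl⟩, rfl⟩ | ⟨i, hi, rfl⟩)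
      · exact ⟨Sum.inr (), Or.inl rfl, rfl⟩
      · exact ⟨_, Or.inr ⟨_, Or.inl ⟨l, hl, rfl⟩, rfl⟩, rfl⟩
      · exact ⟨_, Or.inr ⟨_, Or.inr ⟨i, hi, rfl⟩, rfl⟩, rfl⟩)
  refine ⟨χ, ⊥, isAlgebraicFormula_bot, isStrictFormula_bot, hχ, fun a' y' hr ha' _ => ?_⟩
  refine iff_of_false (fun hy' => heQ (acl_mono h ?_ (hχ' h _ hr))) hy
  rintro _ ⟨_, rfl | ⟨_, ⟨l, hl, rfl⟩ | ⟨i, hi, rfl⟩, rfl⟩, rfl⟩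
  · exact Or.inl hy'
  · exact hl
  · exact Or.inl (ha' i hi)

/-- An element outside the predicate whose algebraicity over `b` and `a` makes essential use of
some coordinate `a j`, `j ∉ I`. The interdependence with `a j` is what makes the formula `τ`
strict. -/
theorem exists_certificate_of_strict {j : Fin n} (hj : j ∉ I) (hy : y ∉ S')
    (hmem : y ∈ acl h (f '' Set.range b ∪ Set.range a))
    (hmem' : a j ∈ acl h (insert y (f '' Set.range b ∪ a '' {j}ᶜ))) :
    ∃ χ τ, IsCertificate.{u, v, w} T₀ h f S S' b I a y χ τ := by
  rw [← Set.range_comp, ← Set.Sum.elim_range, mem_acl_range] at hmem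
  obtain ⟨k, ψ, hψ⟩ := hmem
  let J : Set ((Fin m ⊕ Fin n) ⊕ Unit) := insert (Sum.inr ())
    (Sum.inl '' (Set.range Sum.inl ∪ Sum.inr '' {j}ᶜ))
  obtain ⟨χ, hχ, hχ'⟩ := exists_dependence_formula.{u, v, max u v w} (h := h)
    (c := Sum.elim (Sum.elim (f ∘ b) a) fun _ : Unit => y) (x := Sum.inl (Sum.inr j))
    (J := J) (by
      refine acl_mono h ?_ hmem'
      rintro _ (rfl | ⟨_, ⟨l, rfl⟩, rfl⟩ | ⟨i, hi, rfl⟩)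
      · exact ⟨Sum.inr (), Or.inl rfl, rfl⟩
      · exact ⟨_, Or.inr ⟨_, Or.inl ⟨l, rfl⟩, rfl⟩, rfl⟩
      · exact ⟨_, Or.inr ⟨_, Or.inr ⟨i, hi, rfl⟩, rfl⟩, rfl⟩)
  refine ⟨bdd k ψ ⊓ χ, bdd k ψ ⊓ χ, ⟨k, fun M' c => ?_⟩, ?_, ?_, fun a' y' hr _ hτ => ?_⟩
  · refine (Set.encard_le_encard fun t ht => ?_).trans (encard_bdd_le k ψ c)
    exact (Formula.realize_inf.1 ht).1
  · intro M' b' a' hind t ht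
    rw [Formula.realize_inf, ← LHom.realize_onFormula (LHom.id L₀) χ,
      ← LHom.realize_onFormula (LHom.id L₀) (bdd k ψ)] at ht
    have h1 : t ∈ acl (LHom.id L₀) (Set.range b' ∪ Set.range a') := by
      rw [← Set.Sum.elim_range]
      exact (mem_acl_range _).2 ⟨k, ψ, ht.1⟩
    refine ⟨h1, fun h2 => hind ⟨j, hj⟩ ?_⟩
    have h3 := hχ' (LHom.id L₀) _ ht.2
    refine acl_idem _ (acl_mono _ ?_ h3)
    rintro _ ⟨_, rfl | ⟨_, ⟨l, rfl⟩ | ⟨i, hi, rfl⟩, rfl⟩, rfl⟩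
    · exact acl_mono _ Set.subset_union_left h2
    · exact subset_acl _ _ (Or.inl (Or.inl ⟨l, rfl⟩))
    · refine subset_acl _ _ ?_
      by_cases hiI : i ∈ I
      · exact Or.inl (Or.inr ⟨i, hiI, rfl⟩)
      · exact Or.inr ⟨⟨i, hiI⟩, fun h => hi (congrArg Subtype.val h), rfl⟩
  · let := h.reduct N
    rw [LHom.realize_onFormula] at hχ hψ ⊢
    exact Formula.realize_inf.2 ⟨hψ, hχ⟩
  · exact iff_of_false (hτ y' hr) hy

end Certificates

/-! ### Copying tuples of strong extensions -/

section ExistentiallyClosed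

variable {L₀ : FirstOrder.Language.{u, v}} {L : FirstOrder.Language.{u, v}} {h : L₀ →ᴸ L}
  {T₀ : L₀.Theory} {T : L.Theory}
  {θ : ∀ m n : ℕ, L.Formula (Fin m ⊕ Fin n) → L.Formula (Fin m)}

theorem exists_fin_range {α : Type*} {F : Set α} (hF : F.Finite) :
    ∃ (n : ℕ) (b : Fin n → α), Function.Injective b ∧ Set.range b = F := by
  have := hF.to_subtype
  obtain ⟨n, ⟨e⟩⟩ := Finite.exists_equiv_fin F
  refine ⟨n, fun i => e.symm i, Subtype.val_injective.comp e.symm.injective, ?_⟩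
  change Set.range (Subtype.val ∘ e.symm) = F
  rw [EquivLike.range_comp, Subtype.range_coe]

theorem independentOver_comp_iff {M : Type*} [L.Structure M] {ι κ : Type*} {c : ι → M}
    {r : κ → ι} (hr : Function.Injective r) {D : Set M} :
    IndependentOver h (c ∘ r) D ↔ IndepOn (acl h) c (Set.range r) D := by
  have : ∀ i, (c ∘ r) '' {j | j ≠ i} = c '' (Set.range r \ {r i}) := by
    intro i
    rw [Set.image_comp]
    congr 1
    ext x
    constructor
    · rintro ⟨j, hj, rfl⟩
      exact ⟨⟨j, rfl⟩, fun hji => hj (hr hji)⟩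
    · rintro ⟨⟨j, rfl⟩, hj⟩
      exact ⟨j, fun hji => hj (congrArg r hji), rfl⟩
  simp only [IndependentOver, IndepOn, this, Set.forall_mem_range]
  rfl

/-- Independence in the sense of tuples, for subfamilies of a finite family. -/
theorem Indep.indepOn {M : Type*} [L.Structure M] {A C B : Set M} (hind : Indep h A C B)
    {ι : Type*} [Finite ι] {c : ι → M} {J : Set ι} (hJ : ∀ j ∈ J, c j ∈ A)
    (hc : IndepOn (acl h) c J C) : IndepOn (acl h) c J (C ∪ B) := by
  obtain ⟨n, r, hr, rfl⟩ := exists_fin_range (Set.toFinite J)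
  rw [← independentOver_comp_iff hr] at hc ⊢
  exact hind n _ (fun i => hJ _ ⟨i, rfl⟩) hc

/-- The generic axioms allow to copy any finite tuple of a strong extension into the small pair,
preserving a given formula and the predicate. -/
theorem exists_copy (h_red : IsReduct h T₀ T) (H3 : IsPregeometric.{u, v, w} T₀)
    (H4 : ∀ (m n : ℕ) (φ : L.Formula (Fin m ⊕ Fin n)),
      DefinesGenericity.{u, v, w} h T φ (θ m n φ))
    {M N : Pair.{u, v, w} h T} (hM : SatisfiesScheme.{u, v, w} h T₀ θ M.S)
    (f : M.model ↪ₑ[L] N.model) (hf : ∀ x, f x ∈ N.S ↔ x ∈ M.S)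
    (hind : Indep h N.S (f '' M.S) (Set.range f)) {Z : Type} [Finite Z] (c : Z → N.model)
    {m : ℕ} (b : Fin m → M.model) (φ : L.Formula (Fin m ⊕ Z))
    (hφ : φ.Realize (Sum.elim (f ∘ b) c)) :
    ∃ c' : Z → M.model, φ.Realize (Sum.elim b c') ∧ ∀ z, c' z ∈ M.S ↔ c z ∈ N.S := by
  have hcl := isPregeometry_acl h_red H3 N.model
  have hMcl := isPregeometry_acl h_red H3 M.model
  have hMS : f '' M.S ⊆ Set.range f := Set.image_subset_range _ _
  -- A basis `I` of the part of the tuple in the predicate, extended to a basis `K` of the tuple.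
  obtain ⟨I, -, hIS, hI, hIgen⟩ := hcl.exists_basis (a := c) (I := ∅) (A := {z | c z ∈ N.S})
    (D := Set.range f) (fun _ h => h.elim) (Set.empty_subset _)
  obtain ⟨K, hIK, -, hK, hKgen⟩ := hcl.exists_basis hI (Set.subset_univ _)
  obtain ⟨n, κ, hκ, hκK⟩ := exists_fin_range (Set.toFinite K)
  -- By strongness, the elements of the predicate in the closure of `I` over `M` are already in its
  -- closure over the small predicate.
  have hN : ∀ z, c z ∈ N.S → c z ∈ acl h (f '' M.S ∪ c '' I) := by
    intro z hz
    by_contra hmem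
    have h1 := hind.indepOn (J := insert z I)
      (fun j hj => hj.elim (fun h => h ▸ hz) fun h => hIS h)
      (hcl.indepOn_insert (hcl.indepOn_mono hI subset_rfl (hMS.trans (hcl.subset _))) hmem)
    have hzI : z ∉ I := fun h => hmem (hcl.subset _ (Or.inr ⟨z, h, rfl⟩))
    have h2 := h1 z (Set.mem_insert _ _)
    rw [Set.insert_sdiff_self_of_notMem hzI, Set.union_eq_self_of_subset_left hMS] at h2
    exact h2 (hIgen z hz)
  -- Finitely many parameters suffice to decide which elements of the tuple are in the predicate.
  have hcert : ∀ z, ∃ F : Set M.model, F.Finite ∧ ∀ (m' : ℕ) (b' : Fin m' → M.model),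
      F ⊆ Set.range b' → ∃ χ τ, IsCertificate.{u, v, w} T₀ h f M.S N.S b' (κ ⁻¹' I) (c ∘ κ)
        (c z) χ τ := by
    intro z
    have hIκ : (c ∘ κ) '' (κ ⁻¹' I) = c '' I := by
      rw [Set.image_comp, Set.image_preimage_eq_of_subset (hκK ▸ hIK)]
    have hKκ : Set.range (c ∘ κ) = c '' K := by
      rw [Set.range_comp, hκK]
    by_cases hz : c z ∈ N.S
    -- An element of the predicate.
    · have h1 := hN z hz
      rw [Set.union_comm] at h1
      obtain ⟨_, hF, hfin, h1⟩ := hcl.finitary_right h1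
      obtain ⟨F, hFS, rfl⟩ := Set.subset_image_iff.1 hF
      refine ⟨F, hfin.of_finite_image f.injective.injOn, fun m' b' hb' => ?_⟩
      refine exists_certificate_of_mem M.closed hz (hcl.mono ?_ h1)
      rw [hIκ, Set.union_comm]
      exact Set.union_subset_union_left _ (Set.image_mono (Set.subset_inter hb' hFS))
    by_cases hzI : c z ∈ acl h (Set.range f ∪ c '' I)
    -- An element outside the predicate that does not involve coordinates outside `I`.
    · have h0 : c z ∉ acl h (f '' M.S ∪ c '' I) := by
        intro hmem
        refine hz (N.closed (hcl.mono (Set.union_subset ?_ ?_) hmem))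
        · rintro _ ⟨x, hx, rfl⟩
          exact (hf x).2 hx
        · rintro _ ⟨i, hi, rfl⟩
          exact hIS hi
      obtain ⟨Q, hQ, _, ⟨e, rfl⟩, h1, h2⟩ := hcl.exists_interdependent (B := Set.range f)
        (A := f '' M.S ∪ c '' I) (hcl.mono (by
          rw [Set.union_right_comm]
          exact Set.union_subset_union_left _ Set.subset_union_right) hzI) h0
      obtain ⟨Q, rfl⟩ := Set.subset_range_iff_exists_image_eq.1 hQ
      rw [Set.union_right_comm, ← Set.image_union] at h1 h2
      rw [Set.union_comm, ← Set.insert_union] at h1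
      obtain ⟨_, hF, hfin, h1⟩ := hcl.finitary_right h1
      obtain ⟨F, hFS, rfl⟩ := Set.subset_image_iff.1 hF
      refine ⟨insert e F, (hfin.of_finite_image f.injective.injOn).insert e,
        fun m' b' hb' => ?_⟩
      refine exists_certificate_of_interdependent (Q := Q) hz (hb' (Set.mem_insert _ _))
        (fun hmem => h2 ?_) (hcl.mono ?_ h1)
      · exact hcl.mono Set.subset_union_left ((mem_acl_elementary h f).2 hmem)
      · rw [hIκ, Set.insert_union]
        refine Set.insert_subset_insert (Set.union_subset Set.subset_union_right ?_)
        exact (Set.image_mono (Set.subset_inter ((Set.subset_insert _ _).trans hb') hFS)).trans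
          Set.subset_union_left
    -- An element that is interdependent with a coordinate in `K` but outside `I`.
    · have hIK' : Set.range f ∪ c '' I ∪ c '' K = c '' K ∪ Set.range f := by
        rw [Set.union_assoc, ← Set.image_union, Set.union_eq_self_of_subset_left hIK,
          Set.union_comm]
      have h0 := hKgen z trivial
      obtain ⟨Q, hQ, _, ⟨i, hi, rfl⟩, h1, h2⟩ := hcl.exists_interdependent
        (A := Set.range f ∪ c '' I) (B := c '' K) (by rwa [hIK', Set.union_comm]) hzI
      obtain ⟨j, rfl⟩ : i ∈ Set.range κ := hκK ▸ hi
      have hj : κ j ∉ I := fun h => h2 (hcl.subset _ (Or.inl (Or.inr ⟨_, h, rfl⟩)))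
      have hsub : c '' I ∪ Q ⊆ (c ∘ κ) '' {j}ᶜ := by
        intro x hx
        have hxK : x ∈ c '' K := hx.elim (fun h => Set.image_mono hIK h) fun h => hQ h
        rw [← hκK, ← Set.range_comp] at hxK
        obtain ⟨l, rfl⟩ := hxK
        refine ⟨l, fun hlj => h2 (hcl.subset _ ?_), rfl⟩
        obtain rfl : l = j := hlj
        exact hx.elim (fun h => Or.inl (Or.inr h)) fun h => Or.inr h
      have h3 : c (κ j) ∈ acl h (insert (c z) ((c ∘ κ) '' {j}ᶜ) ∪ Set.range f) := by
        refine hcl.mono ?_ h1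
        rw [Set.insert_union, Set.union_assoc]
        refine Set.insert_subset_insert (Set.union_subset Set.subset_union_right ?_)
        exact hsub.trans Set.subset_union_left
      rw [Set.union_comm, ← hKκ] at h0
      obtain ⟨_, hF, hfin, h0⟩ := hcl.finitary_right h0
      obtain ⟨_, hF', hfin', h3⟩ := hcl.finitary_right h3
      obtain ⟨F, rfl⟩ := Set.subset_range_iff_exists_image_eq.1 hF
      obtain ⟨F', rfl⟩ := Set.subset_range_iff_exists_image_eq.1 hF'
      refine ⟨F ∪ F', (hfin.of_finite_image f.injective.injOn).union
        (hfin'.of_finite_image f.injective.injOn), fun m' b' hb' => ?_⟩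
      refine exists_certificate_of_strict (j := j) hj hz (hcl.mono ?_ h0) (hcl.mono ?_ h3)
      · exact Set.union_subset Set.subset_union_right
          ((Set.image_mono (Set.subset_union_left.trans hb')).trans Set.subset_union_left)
      · rw [Set.insert_union]
        exact Set.insert_subset_insert (Set.union_subset Set.subset_union_right
          ((Set.image_mono (Set.subset_union_right.trans hb')).trans Set.subset_union_left))
  choose F hF hcert using hcert
  obtain ⟨m', b', -, hb'⟩ := exists_fin_range
    ((Set.finite_range b).union (Set.finite_iUnion hF))
  choose χ τ hχ using fun z => hcert z m' b' (by
    rw [hb']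
    exact (Set.subset_iUnion F z).trans Set.subset_union_right)
  have hρ : ∀ l, ∃ l', b' l' = b l := fun l => by
    have : b l ∈ Set.range b' := hb' ▸ Or.inl ⟨l, rfl⟩
    exact this
  choose ρ hρ using hρ
  -- The formula to which the generic axiom is applied.
  let Φ : L.Formula (Fin m' ⊕ Fin n) := Formula.iExs Z
    (φ.relabel (Sum.elim (fun l => Sum.inl (Sum.inl (ρ l))) Sum.inr) ⊓
    ((Formula.iInf fun z : Z => (h.onFormula (χ z)).relabel
      (Sum.elim Sum.inl fun _ => Sum.inr z)) ⊓
    (Formula.iInf fun i : Fin n =>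
      (Term.var (Sum.inr (κ i))).equal (Term.var (Sum.inl (Sum.inr i))))))
  have hΦ : ∀ {X : Type (max u v w)} [L.Structure X] (p : Fin m' → X) (a : Fin n → X),
      Φ.Realize (Sum.elim p a) ↔ ∃ d : Z → X, φ.Realize (Sum.elim (p ∘ ρ) d) ∧
        (∀ z, (h.onFormula (χ z)).Realize (Sum.elim (Sum.elim p a) fun _ => d z)) ∧
        ∀ i, d (κ i) = a i := by
    intro X _ p a
    simp only [Φ, Formula.realize_iExs, Formula.realize_inf, Formula.realize_iInf,
      Formula.realize_relabel, Formula.realize_equal, Term.realize_var, Sum.elim_inr,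
      Sum.elim_inl, Sum.comp_elim, Sum.elim_comp_inl, Sum.elim_comp_inr]
    rfl
  have hθ : (θ m' n Φ).Realize b' := by
    refine (H4 m' n Φ M.model b').2 ⟨N.model, f, c ∘ κ, (hΦ _ _).2 ⟨c, ?_, fun z => ?_, ?_⟩, ?_⟩
    · rwa [show (f ∘ b') ∘ ρ = f ∘ b from funext fun l => congrArg f (hρ l)]
    · exact (hχ z).realize
    · exact fun i => rfl
    · rwa [independentOver_comp_iff hκ, hκK]
  obtain ⟨k, ⟨e⟩⟩ := Finite.exists_equiv_fin Z
  obtain ⟨a', hΦ', haS, hτ⟩ := hM m' n k (κ ⁻¹' I) Φ (fun l => τ (e.symm l))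
    (fun l => ⟨(hχ _).algebraic, (hχ _).strict⟩) b' hθ
  obtain ⟨c', hφ', hχ', -⟩ := (hΦ _ _).1 hΦ'
  refine ⟨c', ?_, fun z => (hχ z).decides a' (c' z) (hχ' z) haS fun t ht => ?_⟩
  · rwa [show b' ∘ ρ = b from funext hρ] at hφ'
  · refine hτ (e z) t ?_
    rwa [Equiv.symm_apply_apply]

end ExistentiallyClosed

/-! ### Robinson's test and quantifier-free formulas with a predicate -/

section Robinson

variable {L : FirstOrder.Language.{u, v}} {T : L.Theory}

/-- The conjunction of finitely many quantifier-free formulas. -/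
theorem exists_isQF_conj {α : Type*} (Δ : Finset (L.Formula α)) (hΔ : ∀ ψ ∈ Δ, ψ.IsQF) :
    ∃ Ψ : L.Formula α, Ψ.IsQF ∧ ∀ {M : Type w} [L.Structure M] (v : α → M),
      Ψ.Realize v ↔ ∀ ψ ∈ Δ, ψ.Realize v := by
  classical
  induction Δ using Finset.induction_on with
  | empty => exact ⟨⊤, BoundedFormula.IsQF.top, fun v => by simp⟩
  | @insert ψ Δ _ ih =>
    obtain ⟨Ψ, hΨ, hΨ'⟩ := ih fun χ hχ => hΔ χ (Finset.mem_insert_of_mem hχ)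
    refine ⟨ψ ⊓ Ψ, (hΔ ψ (Finset.mem_insert_self _ _)).inf hΨ, fun v => ?_⟩
    rw [Formula.realize_inf, hΨ', Finset.forall_mem_insert]

/-- A map preserving all quantifier-free formulas is an embedding. -/
def embeddingOfRealize {M N : Type*} [L.Structure M] [L.Structure N] (g : M → N)
    (H : ∀ γ : L.Formula M, γ.IsQF → γ.Realize id → γ.Realize g) : M ↪[L] N where
  toFun := g
  inj' x y hxy := by
    by_contra hne
    refine H ((Term.var x).equal (Term.var y)).not
      (BoundedFormula.IsAtomic.equal _ _).isQF.not ?_ ?_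
    · rw [Formula.realize_not, Formula.realize_equal]
      exact hne
    · exact Formula.realize_equal.2 hxy
  map_fun' F x := by
    have := H ((Term.func F fun i => Term.var (x i)).equal (Term.var (Structure.funMap F x)))
      (BoundedFormula.IsAtomic.equal _ _).isQF (by simp)
    rw [Formula.realize_equal] at this
    exact this.symm
  map_rel' R x := by
    constructor
    · intro hg
      by_contra hx
      refine H (R.formula fun i => Term.var (x i)).not
        (BoundedFormula.IsAtomic.rel _ _).isQF.not ?_ ?_
      · rw [Formula.realize_not, Formula.realize_rel]
        exact hx
      · exact Formula.realize_rel.2 hg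
    · intro hx
      have := H (R.formula fun i => Term.var (x i)) (BoundedFormula.IsAtomic.rel _ _).isQF
        (Formula.realize_rel.2 hx)
      exact Formula.realize_rel.1 this

/-- If `M` is existentially closed in `N`, then `N` embeds over `M` in an elementary extension
of `M`. -/
theorem exists_elementary_extension {M N : Theory.ModelType.{u, v, max u v w} T} (f : M ↪[L] N)
    (hf : IsExistentiallyClosedIn f) :
    ∃ (M' : Theory.ModelType.{u, v, max u v w} T) (e : M ↪ₑ[L] M') (g : N ↪[L] M'),
      ∀ x, g (f x) = e x := by
  classical
  -- The elementary diagram of `M` together with the quantifier-free diagram of `N`.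
  let Γ : Set (L.Formula N) := {γ | ∃ φ : L.Formula M, φ.Realize id ∧ φ.relabel f = γ} ∪
    {γ | γ.IsQF ∧ γ.Realize id}
  obtain ⟨M', v, hv⟩ := exists_realize_of_finitely_satisfiable.{u, v, w} (T := T) Γ (by
    intro Δ hΔ
    choose s φ' hs using fun γ : L.Formula N => exists_finset_support.{u, v, max u v w} γ
    have hsupp : ∀ (γ : L.Formula N) {X : Type (max u v w)} [L.Structure X] (p q : N → X),
        (∀ x ∈ s γ, p x = q x) → γ.Realize p → γ.Realize q := by
      intro γ X _ p q hpq hp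
      rw [← hs] at hp ⊢
      rwa [show (fun a : s γ => q a) = fun a : s γ => p a from
        funext fun a => (hpq a a.2).symm]
    obtain ⟨Ψ, hΨ, hΨ'⟩ := exists_isQF_conj.{u, v, max u v w}
      (Δ.filter fun γ => γ.IsQF ∧ γ.Realize (id : N → N)) fun γ hγ => (Finset.mem_filter.1 hγ).2.1
    let U : Finset N := Δ.biUnion s
    obtain ⟨x₀⟩ := M.nonempty'
    obtain ⟨m, b, -, hb⟩ := exists_fin_range (F := insert x₀ (f ⁻¹' U))
      ((U.finite_toSet.preimage f.injective.injOn).insert x₀)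
    obtain ⟨n, a, ha, haU⟩ := exists_fin_range (F := (U : Set N)) U.finite_toSet
    have hr : ∀ x : N, ∃ i : Fin m ⊕ Fin n, (x ∈ U → Sum.elim (f ∘ b) a i = x) ∧
        (x ∈ U → x ∈ Set.range f → ∃ l, i = Sum.inl l) := by
      intro x
      by_cases hx : x ∈ U
      · by_cases hxf : x ∈ Set.range f
        · obtain ⟨y, rfl⟩ := hxf
          obtain ⟨l, rfl⟩ : y ∈ Set.range b := hb ▸ Or.inr hx
          exact ⟨Sum.inl l, fun _ => rfl, fun _ _ => ⟨l, rfl⟩⟩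
        · obtain ⟨i, rfl⟩ : x ∈ Set.range a := haU ▸ hx
          exact ⟨Sum.inr i, fun _ => rfl, fun _ h => absurd h hxf⟩
      · obtain ⟨l, -⟩ : x₀ ∈ Set.range b := hb ▸ Or.inl rfl
        exact ⟨Sum.inl l, fun h => absurd h hx, fun h => absurd h hx⟩
    choose r hr hr' using hr
    -- Elements of `U` in `M` are parameters of the formula, the others are its variables.
    obtain ⟨a', ha'⟩ := hf m n (Ψ.relabel r) (BoundedFormula.IsQF.relabel hΨ _) b ⟨a, by
      rw [Formula.realize_relabel, hΨ']
      intro γ hγ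
      obtain ⟨hγΔ, -, hγ⟩ := Finset.mem_filter.1 hγ
      exact hsupp γ id _ (fun x hx => (hr x (Finset.mem_biUnion.2 ⟨γ, hγΔ, hx⟩)).symm) hγ⟩
    rw [Formula.realize_relabel, hΨ'] at ha'
    -- The assignment sends elements of `M` to themselves.
    let p : N → M := fun x => if hx : x ∈ Set.range f then hx.choose else Sum.elim b a' (r x)
    have hp : ∀ x, p (f x) = x := by
      intro x
      have hx : f x ∈ Set.range f := ⟨x, rfl⟩
      have : p (f x) = hx.choose := dif_pos hx
      rw [this]
      exact f.injective hx.choose_spec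
    have hpU : ∀ x ∈ U, Sum.elim b a' (r x) = p x := by
      intro x hx
      by_cases hxf : x ∈ Set.range f
      · obtain ⟨l, hl⟩ := hr' x hx hxf
        have h1 := hr x hx
        rw [hl] at h1 ⊢
        obtain rfl : f (b l) = x := h1
        exact (hp _).symm
      · have : p x = Sum.elim b a' (r x) := dif_neg hxf
        exact this.symm
    refine ⟨M, p, fun γ hγ => ?_⟩
    rcases hΔ hγ with ⟨φ, hφ, rfl⟩ | hqf
    · rw [Formula.realize_relabel]
      rwa [show p ∘ f = id from funext hp]
    · refine hsupp γ _ p (fun x hx => hpU x (Finset.mem_biUnion.2 ⟨γ, hγ, hx⟩))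
        (ha' γ (Finset.mem_filter.2 ⟨hγ, hqf⟩)))
  refine ⟨M', elementaryOfRealize (fun x => v (f x)) fun γ hγ => ?_,
    embeddingOfRealize v fun γ hγ hγ' => hv γ (Or.inr ⟨hγ, hγ'⟩), fun x => rfl⟩
  have := hv (γ.relabel f) (Or.inl ⟨γ, hγ, rfl⟩)
  rwa [Formula.realize_relabel] at this

/-- Robinson's test. -/
theorem isModelComplete_of_existentiallyClosed
    (H : ∀ (M N : Theory.ModelType.{u, v, max u v w} T) (f : M ↪[L] N),
      IsExistentiallyClosedIn f) : IsModelComplete.{u, v, w} T := by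
  have key : ∀ {α : Type} {n : ℕ} (φ : L.BoundedFormula α n)
      (M N : Theory.ModelType.{u, v, max u v w} T) (f : M ↪[L] N) (x : α → M) (xs : Fin n → M),
      φ.Realize (f ∘ x) (f ∘ xs) ↔ φ.Realize x xs := by
    intro α n φ
    induction φ with
    | falsum => exact fun _ _ _ _ _ => Iff.rfl
    | equal t₁ t₂ =>
      exact fun M N f x xs => (BoundedFormula.IsAtomic.equal t₁ t₂).isQF.realize_embedding f
    | rel R ts =>
      exact fun M N f x xs => (BoundedFormula.IsAtomic.rel R ts).isQF.realize_embedding f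
    | imp _ _ ih₁ ih₂ => exact fun M N f x xs => imp_congr (ih₁ M N f x xs) (ih₂ M N f x xs)
    | all φ ih =>
      intro M N f x xs
      constructor
      · intro hN y
        have := hN (f y)
        rwa [← Fin.comp_snoc, ih] at this
      · intro hM d
        obtain ⟨M', e, g, hg⟩ := exists_elementary_extension f (H M N f)
        have h1 := (e.map_boundedFormula φ.all x xs).2 hM (g d)
        rw [← ih N M' g, Fin.comp_snoc]
        rwa [show g ∘ f ∘ x = e ∘ x from funext fun _ => hg _,
          show g ∘ f ∘ xs = e ∘ xs from funext fun _ => hg _]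
  intro M N f n ψ x
  have := key ψ M N f x default
  rwa [show f ∘ (default : Fin 0 → M) = default from Subsingleton.elim _ _] at this

end Robinson

section QuantifierFree

variable {L : FirstOrder.Language.{u, v}}

theorem exists_reduct_term {β : Type*} (t : (withPred L).Term β) :
    ∃ t' : L.Term β, ∀ {M : Type w} [(withPred L).Structure M] [L.Structure M]
      [(incl L).IsExpansionOn M] (x : β → M), t'.realize x = t.realize x := by
  induction t with
  | var i => exact ⟨Term.var i, fun x => rfl⟩
  | @func l F ts ih =>
    choose ts' hts' using ih
    rcases F with F | F
    · refine ⟨Term.func F ts', fun {M} _ _ _ x => ?_⟩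
      simp only [Term.realize_func, hts']
      exact ((incl L).map_onFunction F _).symm
    · exact F.elim

/-- The truth of a quantifier-free formula of the language with the predicate is determined by
the truth of finitely many formulas of the language without it, and by the membership of
finitely many terms in the predicate. -/
theorem exists_determining {α : Type*} {ψ : (withPred L).BoundedFormula α 0} (hψ : ψ.IsQF) :
    ∃ (s : Set (L.Term α)) (X : Set (L.Formula α)), s.Finite ∧ X.Finite ∧
      ∀ {M N : Type w} [(withPred L).Structure M] [L.Structure M] [(incl L).IsExpansionOn M]
        [(withPred L).Structure N] [L.Structure N] [(incl L).IsExpansionOn N]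
        (x : α → M) (y : α → N),
        (∀ t ∈ s, t.realize x ∈ predSet L M ↔ t.realize y ∈ predSet L N) →
        (∀ χ ∈ X, χ.Realize x ↔ χ.Realize y) →
        (ψ.Realize x default ↔ ψ.Realize y default) := by
  have hterm : ∀ t : (withPred L).Term (α ⊕ Fin 0), ∃ t' : L.Term α, ∀ {M : Type w}
      [(withPred L).Structure M] [L.Structure M] [(incl L).IsExpansionOn M] (x : α → M),
      t'.realize x = t.realize (Sum.elim x default) := by
    intro t
    obtain ⟨t', ht'⟩ := exists_reduct_term.{u, v, w} t
    refine ⟨t'.relabel (Sum.elim id Fin.elim0), fun x => ?_⟩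
    rw [Term.realize_relabel, ← ht']
    congr 1
    funext i
    rcases i with i | i
    · rfl
    · exact i.elim0
  induction hψ with
  | falsum => exact ⟨∅, ∅, Set.finite_empty, Set.finite_empty, fun x y _ _ => Iff.rfl⟩
  | of_isAtomic hat =>
    cases hat with
    | equal t₁ t₂ =>
      obtain ⟨t₁', h₁⟩ := hterm t₁
      obtain ⟨t₂', h₂⟩ := hterm t₂
      refine ⟨∅, {t₁'.equal t₂'}, Set.finite_empty, Set.finite_singleton _, fun x y _ hX => ?_⟩
      have := hX _ rfl
      simpa only [Formula.realize_equal, h₁, h₂, BoundedFormula.realize_bdEqual] using this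
    | @rel l R ts =>
      choose ts' hts' using fun i => hterm (ts i)
      rcases R with R | R
      · refine ⟨∅, {R.formula ts'}, Set.finite_empty, Set.finite_singleton _,
          fun {M N} _ _ _ _ _ _ x y _ hX => ?_⟩
        have := hX _ rfl
        rw [Formula.realize_rel, Formula.realize_rel] at this
        simp only [hts'] at this
        change Structure.RelMap ((incl L).onRelation R) (fun i => (ts i).realize _) ↔
          Structure.RelMap ((incl L).onRelation R) (fun i => (ts i).realize _)
        rw [LHom.map_onRelation, LHom.map_onRelation]
        exact this
      · cases R
        refine ⟨{ts' 0}, ∅, Set.finite_singleton _, Set.finite_empty,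
          fun {M N} _ _ _ _ _ _ x y hs _ => ?_⟩
        have := hs _ rfl
        rw [hts', hts'] at this
        have hvec : ∀ {M : Type w} (z : Fin 1 → M), z = ![z 0] := fun z =>
          funext fun i => by rw [Subsingleton.elim i 0]; rfl
        change Structure.RelMap (symbS L) (fun i => (ts i).realize _) ↔
          Structure.RelMap (symbS L) (fun i => (ts i).realize _)
        rw [hvec fun i => (ts i).realize (Sum.elim x default),
          hvec fun i => (ts i).realize (Sum.elim y default)]
        exact this
  | imp _ _ ih₁ ih₂ =>
    obtain ⟨s₁, X₁, hs₁, hX₁, H₁⟩ := ih₁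
    obtain ⟨s₂, X₂, hs₂, hX₂, H₂⟩ := ih₂
    refine ⟨s₁ ∪ s₂, X₁ ∪ X₂, hs₁.union hs₂, hX₁.union hX₂, fun x y hs hX => ?_⟩
    exact imp_congr
      (H₁ x y (fun t ht => hs t (Or.inl ht)) fun χ hχ => hX χ (Or.inl hχ))
      (H₂ x y (fun t ht => hs t (Or.inr ht)) fun χ hχ => hX χ (Or.inr hχ))

end QuantifierFree

/-! ### Strong extensions of models of the theory of pairs -/

section Theorem

variable {L₀ : FirstOrder.Language.{u, v}} {L : FirstOrder.Language.{u, v}} {h : L₀ →ᴸ L}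
  {T₀ : L₀.Theory} {T : L.Theory}
  {θ : ∀ m n : ℕ, L.Formula (Fin m ⊕ Fin n) → L.Formula (Fin m)}

theorem indep_congr {L' : FirstOrder.Language.{u, v}} {h' : L₀ →ᴸ L'} {M : Type*}
    [L.Structure M] [L'.Structure M] (hacl : ∀ A : Set M, acl h A = acl h' A) {A C B : Set M} :
    Indep h A C B ↔ Indep h' A C B := by
  simp only [Indep, IndependentOver, hacl]

/-- The elementary embedding of models of `T` underlying an embedding of models of
`pairTheory`. -/
noncomputable def Pair.mapOfModel (h_red : IsReduct h T₀ T) (H1 : IsModelComplete.{u, v, w} T)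
    (H2 : IsModelComplete.{u, v, w} T₀)
    {M N : Theory.ModelType.{u, v, max u v w} (pairTheory h T₀ T)} (f : M ↪[withPred L] N) :
    (Pair.ofModel h_red H2 M).model ↪ₑ[L] (Pair.ofModel h_red H2 N).model :=
  elementaryOfModelComplete H1
    { toFun := f
      inj' := f.injective
      map_fun' := fun F x => f.map_fun (Sum.inl F) x
      map_rel' := fun R x => f.map_rel (Sum.inl R) x }

theorem mem_predSet_map {M N : Type*} [(withPred L).Structure M] [(withPred L).Structure N]
    (f : M ↪[withPred L] N) (x : M) : f x ∈ predSet L N ↔ x ∈ predSet L M := by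
  refine Iff.trans (iff_of_eq ?_) (f.map_rel (symbS L) ![x])
  change Structure.RelMap (symbS L) ![f x] = _
  congr 1
  funext i
  rw [Subsingleton.elim i 0]
  rfl

theorem isStrong_iff (h_red : IsReduct h T₀ T) (H1 : IsModelComplete.{u, v, w} T)
    (H2 : IsModelComplete.{u, v, w} T₀)
    {M N : Theory.ModelType.{u, v, max u v w} (pairTheory h T₀ T)} (f : M ↪[withPred L] N) :
    IsStrong h f ↔ Indep h (Pair.ofModel h_red H2 N).S
      (Pair.mapOfModel h_red H1 H2 f '' (Pair.ofModel h_red H2 M).S)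
      (Set.range (Pair.mapOfModel h_red H1 H2 f)) :=
  indep_congr (@acl_comp_incl _ _ _ N _ (Pair.ofModel h_red H2 N).model.struc
    ⟨fun _ _ => rfl, fun _ _ => rfl⟩)

/-- Every model of `pairTheory` has a strong extension satisfying the generic axioms. -/
theorem exists_isStrong (h_red : IsReduct h T₀ T)
    (H2 : IsModelComplete.{u, v, w} T₀ ∧ InfiniteAclModels.{u, v, w} T₀)
    (H3 : IsPregeometric.{u, v, w} T₀)
    (H4 : ∀ (m n : ℕ) (φ : L.Formula (Fin m ⊕ Fin n)),
      DefinesGenericity.{u, v, w} h T φ (θ m n φ))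
    (M : Theory.ModelType.{u, v, max u v w} (pairTheory h T₀ T)) :
    ∃ (N : Theory.ModelType.{u, v, max u v w}
        (pairTheory h T₀ T ∪ genericScheme.{u, v, w} h T₀ θ)) (f : M ↪[withPred L] N),
      IsStrong h f := by
  obtain ⟨N, s, hN⟩ := exists_strongEmbedding_scheme h_red H3 H4 (Pair.ofModel h_red H2.1 M)
  let N₁ := N.toModel h_red H2.2
  let : L.Structure N₁ := N.model.struc
  have : (incl L).IsExpansionOn N₁ := ⟨fun _ _ => rfl, fun _ _ => rfl⟩
  have hN₁ : N₁ ⊨ pairTheory h T₀ T ∪ genericScheme.{u, v, w} h T₀ θ :=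
    Theory.model_union_iff.2 ⟨N₁.is_model, model_genericScheme_iff.2 hN⟩
  let f : M ↪[withPred L] N₁ :=
    { toFun := s.toElem
      inj' := s.toElem.injective
      map_fun' := fun F x => match F with
        | Sum.inl F => s.toElem.map_fun F x
      map_rel' := fun R x => by
        rcases R with R | R
        · exact s.toElem.map_rel R x
        · cases R
          have hx : x = ![x 0] := funext fun i => by
            rw [Subsingleton.elim i 0]
            rfl
          refine (s.mem_S (x 0)).trans ?_
          rw [hx]
          exact Iff.rfl }
  have hcl := isPregeometry_acl h_red H3 N.model
  have hind : Indep h N.S (s.toElem '' (Pair.ofModel h_red H2.1 M).S) (Set.range s.toElem) := by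
    intro n a ha hind i
    refine hcl.not_mem_of_isFree ((isFree_iff s.toElem).2 s.free) ?_ ?_ (ha i) (hind i)
    · rintro _ ⟨x, hx, rfl⟩
      exact (s.mem_S x).2 hx
    · rintro _ ⟨j, -, rfl⟩
      exact ha j
  exact ⟨@Theory.ModelType.of _ _ N₁ _ hN₁ _, f,
    (indep_congr (@acl_comp_incl _ _ _ N₁ N₁.struc N.model.struc this)).2 hind⟩

/-- A model of the generic axioms is existentially closed in its strong extensions. -/
theorem isExistentiallyClosedIn_of_isStrong (h_red : IsReduct h T₀ T)
    (H1 : IsModelComplete.{u, v, w} T) (H2 : IsModelComplete.{u, v, w} T₀)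
    (H3 : IsPregeometric.{u, v, w} T₀)
    (H4 : ∀ (m n : ℕ) (φ : L.Formula (Fin m ⊕ Fin n)),
      DefinesGenericity.{u, v, w} h T φ (θ m n φ))
    (M N : Theory.ModelType.{u, v, max u v w} (pairTheory h T₀ T))
    (hM : M ⊨ genericScheme.{u, v, w} h T₀ θ) (f : M ↪[withPred L] N) (hf : IsStrong h f) :
    IsExistentiallyClosedIn f := by
  classical
  intro m n ψ hψ b ⟨a, ha⟩
  have : (incl L).IsExpansionOn M := ⟨fun _ _ => rfl, fun _ _ => rfl⟩
  have : (incl L).IsExpansionOn N := ⟨fun _ _ => rfl, fun _ _ => rfl⟩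
  obtain ⟨s, X, hs, hX, hdet⟩ := exists_determining.{u, v, max u v w} hψ
  obtain ⟨k, σ, -, hσ⟩ := exists_fin_range hs
  have := hX.to_subtype
  -- The values of the relevant terms are added to the tuple.
  let c : Fin n ⊕ Fin k → N := Sum.elim a fun j => (σ j).realize (Sum.elim (f ∘ b) a)
  let ι : Fin m ⊕ Fin n → Fin m ⊕ (Fin n ⊕ Fin k) := Sum.map id Sum.inl
  let φ : L.Formula (Fin m ⊕ (Fin n ⊕ Fin k)) :=
    (Formula.iInf fun χ : X => if χ.1.Realize (Sum.elim (f ∘ b) a) then χ.1.relabel ι else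
      (χ.1.relabel ι).not) ⊓
    Formula.iInf fun j : Fin k => (Term.var (Sum.inr (Sum.inr j))).equal ((σ j).relabel ι)
  have hφ : ∀ {Y : Type (max u v w)} [L.Structure Y] (p : Fin m → Y) (d : Fin n ⊕ Fin k → Y),
      φ.Realize (Sum.elim p d) ↔
      (∀ χ ∈ X, χ.Realize (Sum.elim (f ∘ b) a) ↔ χ.Realize (Sum.elim p (d ∘ Sum.inl))) ∧
      ∀ j, d (Sum.inr j) = (σ j).realize (Sum.elim p (d ∘ Sum.inl)) := by
    intro Y _ p d
    simp only [φ, Formula.realize_inf, Formula.realize_iInf, Formula.realize_equal,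
      Term.realize_var, Term.realize_relabel, Sum.elim_inr, ι, Sum.elim_comp_map,
      Function.comp_id]
    refine and_congr ⟨fun H χ hχ => ?_, fun H χ => ?_⟩ Iff.rfl
    · have := H ⟨χ, hχ⟩
      split_ifs at this with hχN
      · rw [Formula.realize_relabel, Sum.elim_comp_map, Function.comp_id] at this
        exact iff_of_true hχN this
      · rw [Formula.realize_not, Formula.realize_relabel, Sum.elim_comp_map,
          Function.comp_id] at this
        exact iff_of_false hχN this
    · have := H χ.1 χ.2
      split_ifs with hχN
      · rw [Formula.realize_relabel, Sum.elim_comp_map, Function.comp_id]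
        exact this.1 hχN
      · rw [Formula.realize_not, Formula.realize_relabel, Sum.elim_comp_map, Function.comp_id]
        exact fun hχ => hχN (this.2 hχ)
  have hM' := (model_genericScheme_iff (N := (M : Type (max u v w)))).1 hM
  obtain ⟨c', hc', hS⟩ := exists_copy h_red H3 H4 (M := Pair.ofModel h_red H2 M)
    (N := Pair.ofModel h_red H2 N) hM'
    (Pair.mapOfModel h_red H1 H2 f) (mem_predSet_map f) ((isStrong_iff h_red H1 H2 f).1 hf) c b φ
    ((hφ _ _).2 ⟨fun _ _ => Iff.rfl, fun _ => rfl⟩)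
  obtain ⟨hX', hσ'⟩ := (hφ _ _).1 hc'
  let a' : Fin n → M := c' ∘ Sum.inl
  refine ⟨a', ?_⟩
  have hXM : ∀ χ ∈ X, χ.Realize (Sum.elim (f ∘ b) a) ↔ χ.Realize (Sum.elim b a') := hX'
  refine (hdet _ _ ?_ hXM).1 ha
  intro t ht
  rw [← hσ] at ht
  obtain ⟨j, rfl⟩ := ht
  have := hS (Sum.inr j)
  rw [hσ'] at this
  exact this.symm

/-- If the pregeometry is modular, then all extensions are strong. -/
theorem isStrong_of_isModular (h_red : IsReduct h T₀ T) (H1 : IsModelComplete.{u, v, w} T)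
    (H2 : IsModelComplete.{u, v, w} T₀) (hmod : IsModular.{u, v, w} T₀)
    {M N : Theory.ModelType.{u, v, max u v w} (pairTheory h T₀ T)} (f : M ↪[withPred L] N) :
    IsStrong h f := by
  rw [isStrong_iff h_red H1 H2]
  let M' := Pair.ofModel h_red H2 M
  let N' := Pair.ofModel h_red H2 N
  let g : M'.model ↪ₑ[L] N'.model := Pair.mapOfModel h_red H1 H2 f
  have hinter : g '' M'.S = N'.S ∩ Set.range g := by
    ext y
    constructor
    · rintro ⟨x, hx, rfl⟩
      exact ⟨(mem_predSet_map f x).2 hx, x, rfl⟩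
    · rintro ⟨hy, x, rfl⟩
      exact ⟨x, (mem_predSet_map f x).1 hy, rfl⟩
  have hrange : acl h (Set.range g) = Set.range g := by
    rw [← Set.image_univ, acl_image_elementary,
      (Set.subset_univ _).antisymm (subset_acl h Set.univ)]
  have hS : acl h N'.S = N'.S := N'.closed.antisymm (subset_acl h _)
  change Indep h N'.S (g '' M'.S) (Set.range g)
  rw [hinter]
  rw [acl_reductModel h_red] at hrange hS
  exact (@indep_congr _ _ _ _ _ N'.model (h.reduct N'.model) _
    (fun A => (acl_reductModel h_red N'.model A).symm) _ _ _).1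
    (hmod (reductModel h_red N'.model) _ _ hS hrange)

end Theorem

end ReductExpansion

open ReductExpansion in
theorem theorem1p4 {L₀ L : FirstOrder.Language.{u, v}} (h : L₀ →ᴸ L) (h_inj : h.Injective)
    (T₀ : L₀.Theory) (T : L.Theory) (h_red : IsReduct h T₀ T)
    (H1 : IsModelComplete.{u, v, w} T)
    (H2 : IsModelComplete.{u, v, w} T₀ ∧ InfiniteAclModels.{u, v, w} T₀)
    (H3 : IsPregeometric.{u, v, w} T₀)
    (θ : ∀ m n : ℕ, L.Formula (Fin m ⊕ Fin n) → L.Formula (Fin m))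
    (H4 : ∀ (m n : ℕ) (φ : L.Formula (Fin m ⊕ Fin n)),
      DefinesGenericity.{u, v, w} h T φ (θ m n φ)) :
    ∃ TS : (withPred L).Theory,
      TS = pairTheory h T₀ T ∪ genericScheme.{u, v, w} h T₀ θ ∧
      pairTheory h T₀ T ⊆ TS ∧
      (∀ M : Theory.ModelType.{u, v, max u v w} (pairTheory h T₀ T),
        ∃ (N : Theory.ModelType.{u, v, max u v w} TS) (f : M ↪[withPred L] N), IsStrong h f) ∧
      (∀ (M : Theory.ModelType.{u, v, max u v w} TS)
        (N : Theory.ModelType.{u, v, max u v w} (pairTheory h T₀ T)) (f : M ↪[withPred L] N),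
        IsStrong h f → IsExistentiallyClosedIn f) ∧
      (IsModular.{u, v, w} T₀ → IsModelCompanion.{u, v, w} TS (pairTheory h T₀ T)) := by
  have hec : ∀ (M : Theory.ModelType.{u, v, max u v w}
      (pairTheory h T₀ T ∪ genericScheme.{u, v, w} h T₀ θ))
      (N : Theory.ModelType.{u, v, max u v w} (pairTheory h T₀ T)) (f : M ↪[withPred L] N),
      IsStrong h f → IsExistentiallyClosedIn f := fun M N f hf =>
    isExistentiallyClosedIn_of_isStrong h_red H1 H2.1 H3 H4
      (M.subtheoryModel Set.subset_union_left) N (Theory.model_union_iff.1 M.is_model).2 f hf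
  refine ⟨_, rfl, Set.subset_union_left, exists_isStrong h_red H2 H3 H4, hec, fun hmod => ?_⟩
  refine ⟨isModelComplete_of_existentiallyClosed fun M N f => ?_, fun M => ?_, fun M => ?_⟩
  · exact hec M (N.subtheoryModel Set.subset_union_left) f
      (isStrong_of_isModular h_red H1 H2.1 hmod
        (M := M.subtheoryModel Set.subset_union_left)
        (N := N.subtheoryModel Set.subset_union_left) f)
  · obtain ⟨N, f, -⟩ := exists_isStrong h_red H2 H3 H4 M
    exact ⟨N, ⟨f⟩⟩
  · exact ⟨M.subtheoryModel Set.subset_union_left, ⟨Embedding.refl _ _⟩⟩
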